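/- A *cubical complex* $Y$ with vertex set $V$ is a family of finite subsets of $V$ (the vertex sets of its cubes) such that every singleton is a cube; every cube is identified with the vertex set $\{0,1\}^n$ of a standard cube $[0,1]^n$, for some finite $n$, by a bijection under which the cubes contained in it correspond exactly to the vertex sets of the nonempty faces of $[0,1]^n$; and any two cubes are disjoint or intersect in a single cube. (Neither finite dimension nor local finiteness is assumed.) $Y$ is *simply connected* if its geometric realization is, that is, the disjoint union of the corresponding standard cubes glued along common faces, with the quotient topology. The *link* $Y_v$ of a vertex $v$ is the simplicial complex whose vertices are the vertices of $Y$ joined to $v$ by an edge, a nonempty finite set of them being a simplex iff it lies together with $v$ in a common cube of $Y$. A simplicial complex is *flag* if every nonempty finite set of its vertices that are pairwise joined by edges is contained in a simplex. A flag simplicial complex $X$ is *$5$-large* if no $4$-cycle $(v_0,v_1,v_2,v_3,v_0)$ of $X$ (four distinct vertices, consecutive ones joined by edges) is a full subcomplex of $X$, i.e. for no such cycle is every simplex of $X$ with all its vertices in the cycle contained in one of the four edges of the cycle. $Y$ is *locally $5$-large* if $Y_v$ is $5$-large for every vertex $v$ of $Y$. The *thickening* $Th(Y)$ is the simplicial complex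 with the same vertices as $Y$ in which a nonempty finite set of vertices is a simplex iff it is contained in a common cube of $Y$. **Proposition 3.4.** Let $Y$ be a simply connected, locally $5$-large cubical complex. Then its thickening $Th(Y)$ is a $5$-large simplicial complex. -/

import Mathlib

/-! ### Simplicial complexes

A simplicial complex is given by the family of its (nonempty, finite) simplices. Its vertices are
the `v` with `{v}` a simplex; a `PreAbstractSimplicialComplex V` need not have all of `V` as
vertices. -/

namespace PreAbstractSimplicialComplex

variable {V : Type*}

/-- Two distinct vertices are joined by an edge iff they lie in a common simplex (equivalently, as
simplices are closed under nonempty subsets, iff the two of them form a simplex). -/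
def oneSkeleton (X : PreAbstractSimplicialComplex V) : SimpleGraph V where
  Adj v w := v ≠ w ∧ ∃ s ∈ X.faces, v ∈ s ∧ w ∈ s
  symm := ⟨fun _ _ ⟨hne, s, hs, hv, hw⟩ => ⟨hne.symm, s, hs, hw, hv⟩⟩
  loopless := ⟨fun _ h => h.1 rfl⟩

/-- Flag: every nonempty finite set of vertices that are pairwise joined by edges is contained in
a simplex. -/
def IsFlag (X : PreAbstractSimplicialComplex V) : Prop :=
  ∀ s : Finset V, s.Nonempty → (∀ v ∈ s, {v} ∈ X.faces) →
    (∀ v ∈ s, ∀ w ∈ s, v ≠ w → X.oneSkeleton.Adj v w) → ∃ t ∈ X.faces, s ⊆ t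

/-- `(c 0, …, c (j-1), c 0)` is a `j`-cycle of `X` (the `c i` are distinct and consecutive ones are
joined by edges) and this cycle is a full subcomplex: every simplex of `X` with all its vertices
in the cycle is contained in a simplex of the cycle, that is, in an edge `⟨c i, c (i+1)⟩`. -/
def IsFullCycle (X : PreAbstractSimplicialComplex V) (j : ℕ) (c : ZMod j → V) : Prop :=
  Function.Injective c ∧
  (∀ i, X.oneSkeleton.Adj (c i) (c (i + 1))) ∧
  ∀ s ∈ X.faces, (∀ v ∈ s, v ∈ Set.range c) → ∃ i, ∀ v ∈ s, v = c i ∨ v = c (i + 1)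

/-- `k`-large (for `k ≥ 4`): flag, and no `j`-cycle with `4 ≤ j < k` is a full subcomplex. -/
def IsLarge (X : PreAbstractSimplicialComplex V) (k : ℕ) : Prop :=
  X.IsFlag ∧ ∀ j, 4 ≤ j → j < k → ∀ c : ZMod j → V, ¬ X.IsFullCycle j c

end PreAbstractSimplicialComplex

/-! ### Cubical complexes -/

/-- The vertex sets of the nonempty faces of the standard cube `[0,1]ⁿ`, whose vertices are the
elements of `{0,1}ⁿ` (`false` is `0` and `true` is `1`): fix some of the coordinates. -/
def IsCubeFace {n : ℕ} (A : Set (Fin n → Bool)) : Prop :=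
  ∃ (S : Set (Fin n)) (a : Fin n → Bool), A = {b | ∀ i ∈ S, b i = a i}

/-- `e` identifies the standard `n`-cube with a cube of the family `𝒞` (a family of vertex sets):
it is injective on vertices and the members of `𝒞` contained in the image are exactly the images
of the faces of the standard cube (the whole cube is one of them). -/
structure IsCubeChart {V : Type*} (𝒞 : Set (Set V)) {n : ℕ} (e : (Fin n → Bool) → V) : Prop where
  injective : Function.Injective e
  image_mem_iff : ∀ A : Set (Fin n → Bool), e '' A ∈ 𝒞 ↔ IsCubeFace A

/-- A cubical complex with vertex set `V`, given by the vertex sets of its cubes: every vertex is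
a cube, every cube is, together with its faces, isomorphic to a standard cube of some finite
dimension, and two cubes are either disjoint or intersect along a single cube (which is then a face
of both). There is no restriction on the dimension, nor any local finiteness. -/
structure CubicalComplex (V : Type*) where
  cubes : Set (Set V)
  vertex_mem : ∀ v : V, {v} ∈ cubes
  exists_chart : ∀ C ∈ cubes, ∃ (n : ℕ) (e : (Fin n → Bool) → V),
    IsCubeChart cubes e ∧ Set.range e = C
  inter_mem : ∀ C ∈ cubes, ∀ D ∈ cubes, (C ∩ D).Nonempty → C ∩ D ∈ cubes

namespace CubicalComplex

variable {V : Type*}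

/-- A parametrization of a cube of `Y` by a standard cube. -/
structure Chart (Y : CubicalComplex V) where
  dim : ℕ
  vert : (Fin dim → Bool) → V
  isChart : IsCubeChart Y.cubes vert

/-- The vertex coordinates of the point with coordinates `x ∈ [0,1]ⁿ` in the cube
parametrized by `c`: the vertex `c b` gets `∏ᵢ (xᵢ if bᵢ = 1, 1 - xᵢ if bᵢ = 0)`, and vertices
outside the cube get `0`. They determine `x`; the vertices with nonzero coordinate are those of the
smallest face containing the point, and the coordinates do not change if that face is parametrized
in another way, as part of any cube of which it is a face. -/
noncomputable def Chart.vertexCoord {Y : CubicalComplex V} (c : Y.Chart)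
    (x : Fin c.dim → unitInterval) : V → ℝ :=
  Function.extend c.vert
    (fun b => ∏ i, if b i = true then (x i : ℝ) else 1 - (x i : ℝ)) (fun _ => 0)

/-- Points of standard cubes are glued iff they have the same vertex coordinates in `Y`, that is,
iff they are the same point of a common face. -/
noncomputable def gluing (Y : CubicalComplex V) : Setoid (Σ c : Y.Chart, (Fin c.dim → unitInterval)) :=
  Setoid.ker fun p => p.1.vertexCoord p.2

/-- The underlying space of `Y`: the disjoint union of the cubes, glued along common faces. -/
def Realization (Y : CubicalComplex V) : Type _ := Quotient Y.gluing

/-- The space carries the quotient topology, that is, the weak (CW) topology. -/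
noncomputable instance (Y : CubicalComplex V) : TopologicalSpace Y.Realization :=
  inferInstanceAs (TopologicalSpace (Quotient Y.gluing))

/-- The link of the vertex `v`. Its vertices, which correspond to the edges of `Y` at `v`, are the
neighbours of `v`; neighbours of `v` span a simplex iff they lie with `v` in a common cube. -/
def link (Y : CubicalComplex V) (v : V) : PreAbstractSimplicialComplex V where
  faces := {s | s.Nonempty ∧ (∀ w ∈ s, w ≠ v ∧ ({v, w} : Set V) ∈ Y.cubes) ∧
    ∃ C ∈ Y.cubes, v ∈ C ∧ (s : Set V) ⊆ C}
  isRelLowerSet_faces := by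
    rintro s ⟨hs, hE, C, hC, hv, hsC⟩
    exact ⟨hs, fun t hts ht => ⟨ht, fun w hw => hE w (hts hw), C, hC, hv,
      fun w hw => hsC (hts hw)⟩⟩

/-- Locally `k`-large: the links of all vertices are `k`-large. -/
def IsLocallyLarge (Y : CubicalComplex V) (k : ℕ) : Prop :=
  ∀ v : V, (Y.link v).IsLarge k

/-- The thickening: same vertices, and a nonempty finite set of vertices is a simplex iff it is
contained in a cube. -/
def thickening (Y : CubicalComplex V) : AbstractSimplicialComplex V where
  faces := {s | s.Nonempty ∧ ∃ C ∈ Y.cubes, (s : Set V) ⊆ C}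
  isRelLowerSet_faces := by
    rintro s ⟨hs, C, hC, hsC⟩
    exact ⟨hs, fun t hts ht => ⟨ht, C, hC, fun w hw => hsC (hts hw)⟩⟩
  singleton_mem v := ⟨Finset.singleton_nonempty v, {v}, Y.vertex_mem v, by simp⟩

end CubicalComplex

/-! Simple connectedness is used only to show that the 1-skeleton is connected, bipartite and
satisfies the quadrangle condition: two neighbours of `v` nearer to `p` than `v` span with `v` a
square whose fourth vertex is nearer still. Consider edge paths modulo moves across squares. Since
links are flag, equivalent paths with the same last vertex differ at the end by at most one square
(`coterminal_of_pathEq`). Hence the classes of paths from a base vertex that cannot be made to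
backtrack form a local system (`reducedPaths`): an edge extends or shortens a class, and the
holonomy around squares is trivial. A local system defines a covering of the realization, which has
a section (`LocalSystem.exists_section`). The section picks one class for each vertex; its length is
the distance to the base vertex, and the quadrangle condition can be read off
(`dist_adj_and_quadrangle`).

The rest is geometry of the distance `d`. The hyperplane dual to an edge `ab` is encoded by
comparing `d r a` with `d r b`. Cubes are gated and convex. Two edges at `m` lie in a common cube if
some vertex lies beyond both hyperplanes, or if two vertices of one cube lie beyond one hyperplane
each (`exists_cube_of_lt`, `exists_cube_of_separated`); flagness passes from edges to cubes
(`exists_cube_of_pairwise`). This makes the thickening flag. Given a 4-cycle of the thickening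
without diagonals, let `m` be the gate of `v₂` in the intersection of a cube through `v₀, v₁` with
one through `v₃, v₀`. Then `m` shares a cube with every `vᵢ`, and suitable edges from `m` towards
the `vᵢ` form a full 4-cycle in the link of `m` (`exists_link_cycle`). -/

open Function

/-! ### Standard cubes. -/

/-- Change the `i`-th coordinate of a vertex of the standard cube. -/
def flipAt {n : ℕ} (b : Fin n → Bool) (i : Fin n) : Fin n → Bool := update b i (!b i)

section flipAt

variable {n : ℕ} (b : Fin n → Bool) {i j : Fin n}

@[simp] lemma flipAt_same (i : Fin n) : flipAt b i i = !b i := by simp [flipAt]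

lemma flipAt_of_ne (h : j ≠ i) : flipAt b i j = b j := by simp [flipAt, h]

@[simp] lemma flipAt_flipAt (i : Fin n) : flipAt (flipAt b i) i = b := by
  ext j; by_cases h : j = i <;> simp [flipAt, h]

lemma flipAt_comm (i j : Fin n) : flipAt (flipAt b i) j = flipAt (flipAt b j) i := by
  ext k
  by_cases h : i = j
  · subst h; rfl
  · by_cases hi : k = i <;> by_cases hj : k = j <;> simp_all [flipAt]

lemma flipAt_ne (i : Fin n) : flipAt b i ≠ b := fun h => by
  have := congrFun h i; simp at this

lemma flipAt_injective : Injective (flipAt b) := fun i j h => by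
  by_contra hij
  have := congrFun h i
  rw [flipAt_same, flipAt_of_ne b hij] at this
  simp at this

/-- If `k ≠ j`, the left side keeps the coordinate `j` of `b`, so the right side has to undo its
flip of `j` and returns to `b`. This makes the fourth vertex of a square unique inside a cube. -/
lemma flipAt_flipAt_eq {k l : Fin n} (hij : i ≠ j)
    (h : flipAt (flipAt b i) k = flipAt (flipAt b j) l) (hb : flipAt (flipAt b i) k ≠ b) :
    k = j := by
  by_contra hk
  by_cases hl : l = j
  · subst hl; simp at h; exact hb h
  · have := congrFun h j
    rw [flipAt_of_ne _ (Ne.symm hk), flipAt_of_ne _ hij.symm, flipAt_of_ne _ (Ne.symm hl)] at this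
    simp at this

/-- The standard cube is connected. -/
lemma flipAt_induction {P : (Fin n → Bool) → Prop} (b₀ : Fin n → Bool) (h₀ : P b₀)
    (h : ∀ b i, P b → P (flipAt b i)) (b : Fin n → Bool) : P b := by
  suffices ∀ s : Finset (Fin n), P (fun i => if i ∈ s then b i else b₀ i) by
    simpa using this Finset.univ
  intro s
  induction s using Finset.induction_on with
  | empty => simpa using h₀
  | insert i s hi ih =>
    by_cases hb : b i = b₀ i
    · convert ih using 2 with j
      by_cases hj : j = i
      · subst hj; simp [hb, hi]
      · simp [hj]
    · convert h _ i ih using 1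
      ext j
      by_cases hj : j = i
      · subst hj; cases hb' : b j <;> cases hb₀ : b₀ j <;> simp_all
      · rw [flipAt_of_ne _ hj]; simp [hj]

end flipAt

/-! ### Edges, squares and 3-cubes of a cubical complex. -/

namespace CubicalComplex

variable {V : Type*} (Y : CubicalComplex V)

/-- The `1`-skeleton of a cubical complex. -/
def graph : SimpleGraph V where
  Adj v w := v ≠ w ∧ ({v, w} : Set V) ∈ Y.cubes
  symm := ⟨fun v w h => ⟨h.1.symm, by rw [Set.pair_comm]; exact h.2⟩⟩
  loopless := ⟨fun _ h => h.1 rfl⟩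

/-- `v, u, x, w` are the consecutive vertices of a square of a cube. -/
structure IsSquare (v u w x : V) : Prop where
  adj₁ : Y.graph.Adj v u
  adj₂ : Y.graph.Adj v w
  adj₃ : Y.graph.Adj u x
  adj₄ : Y.graph.Adj w x
  ne₁ : u ≠ w
  ne₂ : v ≠ x
  cube : ∃ C ∈ Y.cubes, v ∈ C ∧ u ∈ C ∧ w ∈ C ∧ x ∈ C

variable {Y}

lemma IsSquare.symm {v u w x : V} (h : Y.IsSquare v u w x) : Y.IsSquare v w u x :=
  ⟨h.adj₂, h.adj₁, h.adj₄, h.adj₃, h.ne₁.symm, h.ne₂, by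
    obtain ⟨C, hC, h1, h2, h3, h4⟩ := h.cube; exact ⟨C, hC, h1, h3, h2, h4⟩⟩

lemma IsSquare.rotate {v u w x : V} (h : Y.IsSquare v u w x) : Y.IsSquare u v x w :=
  ⟨h.adj₁.symm, h.adj₃, h.adj₂, h.adj₄.symm, h.ne₂, h.ne₁, by
    obtain ⟨C, hC, h1, h2, h3, h4⟩ := h.cube; exact ⟨C, hC, h2, h1, h4, h3⟩⟩

section chart

variable {n : ℕ} {e : (Fin n → Bool) → V} (he : IsCubeChart Y.cubes e)
include he

lemma range_mem : Set.range e ∈ Y.cubes := by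
  rw [← Set.image_univ, he.image_mem_iff]
  exact ⟨∅, fun _ => false, by simp⟩

lemma adj_iff {b b' : Fin n → Bool} : Y.graph.Adj (e b) (e b') ↔ ∃ i, b' = flipAt b i := by
  constructor
  · rintro ⟨hne, hC⟩
    rw [← Set.image_pair, he.image_mem_iff] at hC
    obtain ⟨S, a, hS⟩ := hC
    have hbb : b' ≠ b := fun h => hne (by rw [h])
    have hb : b ∈ ({b, b'} : Set _) := by simp
    have hb' : b' ∈ ({b, b'} : Set _) := by simp
    rw [hS] at hb hb'
    obtain ⟨i, hi⟩ := Function.ne_iff.1 hbb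
    have hiS : i ∉ S := fun h => hi (by rw [hb' i h, hb i h])
    have : flipAt b i ∈ ({b, b'} : Set _) := by
      rw [hS]
      intro j hj
      rw [flipAt_of_ne _ (by rintro rfl; exact hiS hj)]
      exact hb j hj
    rcases this with h | h
    · exact absurd h (flipAt_ne b i)
    · exact ⟨i, h.symm⟩
  · rintro ⟨i, rfl⟩
    refine ⟨fun h => flipAt_ne b i (he.injective h).symm, ?_⟩
    rw [← Set.image_pair, he.image_mem_iff]
    refine ⟨{i}ᶜ, b, ?_⟩
    ext x
    constructor
    · rintro (rfl | rfl)
      · intro j _; rfl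
      · intro j hj; exact flipAt_of_ne _ hj
    · intro h
      by_cases hx : x i = b i
      · left; ext j
        by_cases hj : j = i
        · rw [hj, hx]
        · rw [h j hj]
      · right; ext j
        by_cases hj : j = i
        · subst hj; cases hb : b j <;> simp_all
        · rw [h j hj, flipAt_of_ne _ hj]

lemma adj_flipAt (b : Fin n → Bool) (i : Fin n) : Y.graph.Adj (e b) (e (flipAt b i)) :=
  (adj_iff he).2 ⟨i, rfl⟩

lemma isSquare_flipAt (b : Fin n → Bool) {i j : Fin n} (hij : i ≠ j) :
    Y.IsSquare (e b) (e (flipAt b i)) (e (flipAt b j)) (e (flipAt (flipAt b i) j)) where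
  adj₁ := adj_flipAt he b i
  adj₂ := adj_flipAt he b j
  adj₃ := adj_flipAt he _ j
  adj₄ := by rw [flipAt_comm]; exact adj_flipAt he _ i
  ne₁ h := hij (flipAt_injective b (he.injective h))
  ne₂ h := by
    have := congrFun (he.injective h) i
    rw [flipAt_of_ne _ hij] at this
    simp at this
  cube := ⟨_, range_mem he, by simp⟩

lemma eq_of_adj_chart {b x : Fin n → Bool} {i j : Fin n} (hij : i ≠ j)
    (h₁ : Y.graph.Adj (e (flipAt b i)) (e x)) (h₂ : Y.graph.Adj (e (flipAt b j)) (e x))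
    (hx : x ≠ b) : x = flipAt (flipAt b i) j := by
  obtain ⟨k, hk⟩ := (adj_iff he).1 h₁
  obtain ⟨l, hl⟩ := (adj_iff he).1 h₂
  rw [hk, flipAt_flipAt_eq b hij (hk.symm.trans hl) (hk ▸ hx)]

end chart

lemma exists_square {v u w : V} {C : Set V} (hC : C ∈ Y.cubes) (hv : v ∈ C) (hu : u ∈ C)
    (hw : w ∈ C) (hvu : Y.graph.Adj v u) (hvw : Y.graph.Adj v w) (huw : u ≠ w) :
    ∃ x ∈ C, Y.IsSquare v u w x := by
  obtain ⟨n, e, he, rfl⟩ := Y.exists_chart C hC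
  obtain ⟨b, rfl⟩ := hv
  obtain ⟨_, rfl⟩ := hu
  obtain ⟨_, rfl⟩ := hw
  obtain ⟨i, rfl⟩ := (adj_iff he).1 hvu
  obtain ⟨j, rfl⟩ := (adj_iff he).1 hvw
  exact ⟨_, Set.mem_range_self _, isSquare_flipAt he b (fun h => huw (by rw [h]))⟩

lemma eq_of_mem_cube {v u w x x' : V} {C : Set V} (hC : C ∈ Y.cubes) (hv : v ∈ C) (hu : u ∈ C)
    (hw : w ∈ C) (hx : x ∈ C) (hx' : x' ∈ C) (h : Y.IsSquare v u w x) (h' : Y.IsSquare v u w x') :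
    x = x' := by
  obtain ⟨n, e, he, rfl⟩ := Y.exists_chart C hC
  obtain ⟨b, rfl⟩ := hv
  obtain ⟨_, rfl⟩ := hu
  obtain ⟨_, rfl⟩ := hw
  obtain ⟨x, rfl⟩ := hx
  obtain ⟨x', rfl⟩ := hx'
  obtain ⟨i, rfl⟩ := (adj_iff he).1 h.adj₁
  obtain ⟨j, rfl⟩ := (adj_iff he).1 h.adj₂
  have hij : i ≠ j := fun hij => h.ne₁ (by rw [hij])
  rw [eq_of_adj_chart he hij h.adj₃ h.adj₄ (fun hx => h.ne₂ (by rw [hx])),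
    eq_of_adj_chart he hij h'.adj₃ h'.adj₄ (fun hx => h'.ne₂ (by rw [hx]))]

/-- A square is determined by two of its edges, even among all cubes of the complex. -/
lemma IsSquare.unique {v u w x x' : V} (h : Y.IsSquare v u w x) (h' : Y.IsSquare v u w x') :
    x = x' := by
  obtain ⟨C, hC, hv, hu, hw, hx⟩ := h.cube
  obtain ⟨C', hC', hv', hu', hw', hx'⟩ := h'.cube
  -- The intersection of the two cubes is a cube, so it contains a fourth vertex `y`, which must be
  -- both `x` and `x'`.
  obtain ⟨y, hy, hs⟩ := exists_square (Y.inter_mem C hC C' hC' ⟨v, hv, hv'⟩) ⟨hv, hv'⟩ ⟨hu, hu'⟩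
    ⟨hw, hw'⟩ h.adj₁ h.adj₂ h.ne₁
  exact (eq_of_mem_cube hC hv hu hw hx hy.1 h hs).trans
    (eq_of_mem_cube hC' hv' hu' hw' hy.2 hx' hs h')

/-- If the link of `q` is flag, then finitely many neighbours of `q`, any two of them in a common
cube with `q`, all lie in a common cube with `q`. -/
lemma exists_cube_of_isFlag {q : V} (hq : (Y.link q).IsFlag) (s : Finset V)
    (hs : ∀ a ∈ s, Y.graph.Adj q a)
    (h : ∀ a ∈ s, ∀ b ∈ s, a ≠ b → ∃ C ∈ Y.cubes, q ∈ C ∧ a ∈ C ∧ b ∈ C) :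
    ∃ C ∈ Y.cubes, q ∈ C ∧ ∀ a ∈ s, a ∈ C := by
  classical
  rcases s.eq_empty_or_nonempty with rfl | hne
  · exact ⟨{q}, Y.vertex_mem q, by simp⟩
  · obtain ⟨t, ⟨-, -, C, hC, hqC, htC⟩, hst⟩ := hq s hne
      (fun a ha => ⟨by simp, by
        simpa using ⟨(hs a ha).1.symm, (hs a ha).2⟩, _, (hs a ha).2, by simp, by simp⟩)
      (fun a ha b hb hab => ⟨hab, {a, b}, ⟨by simp, by
        simpa using ⟨⟨(hs a ha).1.symm, (hs a ha).2⟩, (hs b hb).1.symm, (hs b hb).2⟩, by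
          obtain ⟨C, hC, h1, h2, h3⟩ := h a ha b hb hab
          exact ⟨C, hC, h1, by simp [Set.insert_subset_iff, h2, h3]⟩⟩, by simp, by simp⟩)
    exact ⟨C, hC, hqC, fun a ha => htC (hst ha)⟩

/-- Three squares around a vertex with flag link span a `3`-cube. -/
lemma exists_three_cube {q a b c ab ac bc : V} (hq : (Y.link q).IsFlag)
    (h₁ : Y.IsSquare q a b ab) (h₂ : Y.IsSquare q a c ac) (h₃ : Y.IsSquare q b c bc) :
    ∃ z, Y.IsSquare a ab ac z ∧ Y.IsSquare ab b z bc ∧ Y.IsSquare ac c z bc := by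
  classical
  obtain ⟨C₁, hC₁, h11, h12, h13, -⟩ := h₁.cube
  obtain ⟨C₂, hC₂, h21, h22, h23, -⟩ := h₂.cube
  obtain ⟨C₃, hC₃, h31, h32, h33, -⟩ := h₃.cube
  obtain ⟨C, hC, hqC, hsC⟩ := exists_cube_of_isFlag hq {a, b, c}
    (by simp [h₁.adj₁, h₁.adj₂, h₂.adj₂])
    (by
      intro x hx y hy hxy
      simp only [Finset.mem_insert, Finset.mem_singleton] at hx hy
      rcases hx with rfl | rfl | rfl <;> rcases hy with rfl | rfl | rfl
      · exact absurd rfl hxy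
      · exact ⟨C₁, hC₁, h11, h12, h13⟩
      · exact ⟨C₂, hC₂, h21, h22, h23⟩
      · exact ⟨C₁, hC₁, h11, h13, h12⟩
      · exact absurd rfl hxy
      · exact ⟨C₃, hC₃, h31, h32, h33⟩
      · exact ⟨C₂, hC₂, h21, h23, h22⟩
      · exact ⟨C₃, hC₃, h31, h33, h32⟩
      · exact absurd rfl hxy)
  have ha := hsC a (by simp)
  have hb := hsC b (by simp)
  have hc := hsC c (by simp)
  obtain ⟨n, e, he, rfl⟩ := Y.exists_chart C hC
  obtain ⟨q, rfl⟩ := hqC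
  obtain ⟨_, rfl⟩ := ha
  obtain ⟨_, rfl⟩ := hb
  obtain ⟨_, rfl⟩ := hc
  obtain ⟨i, rfl⟩ := (adj_iff he).1 h₁.adj₁
  obtain ⟨j, rfl⟩ := (adj_iff he).1 h₁.adj₂
  obtain ⟨k, rfl⟩ := (adj_iff he).1 h₂.adj₂
  have hij : i ≠ j := fun hij => h₁.ne₁ (by rw [hij])
  have hik : i ≠ k := fun hij => h₂.ne₁ (by rw [hij])
  have hjk : j ≠ k := fun hij => h₃.ne₁ (by rw [hij])
  obtain rfl := h₁.unique (isSquare_flipAt he q hij)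
  obtain rfl := h₂.unique (isSquare_flipAt he q hik)
  obtain rfl := h₃.unique (isSquare_flipAt he q hjk)
  refine ⟨e (flipAt (flipAt (flipAt q i) j) k), isSquare_flipAt he _ hjk, ?_, ?_⟩
  · have := isSquare_flipAt he (flipAt (flipAt q i) j) hik
    rwa [flipAt_comm q i j, flipAt_flipAt, ← flipAt_comm q i j] at this
  · have := isSquare_flipAt he (flipAt (flipAt q i) k) hij
    rwa [flipAt_comm q i k, flipAt_flipAt, ← flipAt_comm q i k, flipAt_comm _ k j,
      flipAt_comm q k j] at this

end CubicalComplex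

/-! ### Edge paths modulo squares. -/

namespace CubicalComplex

variable {V : Type*} (Y : CubicalComplex V)

/-- Edge paths are lists of vertices, the last vertex of the path coming first. An elementary
move replaces two consecutive edges of a square by the other two. -/
inductive Move : List V → List V → Prop
  | swap {v u w x : V} (t : List V) (h : Y.IsSquare v u w x) :
      Move (v :: u :: x :: t) (v :: w :: x :: t)
  | cons (v : V) {l l' : List V} (h : Move l l') : Move (v :: l) (v :: l')

/-- Equality of edge paths up to moves across squares. -/
abbrev PathEq : List V → List V → Prop := Relation.EqvGen Y.Move

variable {Y}

lemma Move.length_eq {l l' : List V} (h : Y.Move l l') : l.length = l'.length := by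
  induction h with
  | swap => simp
  | cons _ _ ih => simp [ih]

lemma Move.head?_eq {l l' : List V} (h : Y.Move l l') : l.head? = l'.head? := by
  cases h <;> simp

namespace PathEq

@[refl] lemma refl (l : List V) : Y.PathEq l l := Relation.EqvGen.refl l

lemma symm {l l' : List V} (h : Y.PathEq l l') : Y.PathEq l' l := Relation.EqvGen.symm _ _ h

lemma trans {l l' l'' : List V} (h : Y.PathEq l l') (h' : Y.PathEq l' l'') : Y.PathEq l l'' :=
  Relation.EqvGen.trans _ _ _ h h'

lemma cons (v : V) {l l' : List V} (h : Y.PathEq l l') : Y.PathEq (v :: l) (v :: l') := by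
  induction h with
  | rel _ _ h => exact .rel _ _ (.cons v h)
  | refl => exact .refl _
  | symm _ _ _ ih => exact ih.symm
  | trans _ _ _ _ _ ih ih' => exact ih.trans ih'

lemma swap {v u w x : V} (t : List V) (h : Y.IsSquare v u w x) :
    Y.PathEq (v :: u :: x :: t) (v :: w :: x :: t) := .rel _ _ (.swap t h)

lemma length_eq {l l' : List V} (h : Y.PathEq l l') : l.length = l'.length := by
  induction h with
  | rel _ _ h => exact h.length_eq
  | refl => rfl
  | symm _ _ _ ih => exact ih.symm
  | trans _ _ _ _ _ ih ih' => exact ih.trans ih'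

lemma head?_eq {l l' : List V} (h : Y.PathEq l l') : l.head? = l'.head? := by
  induction h with
  | rel _ _ h => exact h.head?_eq
  | refl => rfl
  | symm _ _ _ ih => exact ih.symm
  | trans _ _ _ _ _ ih ih' => exact ih.trans ih'

lemma head_eq {v w : V} {l l' : List V} (h : Y.PathEq (v :: l) (w :: l')) : v = w := by
  simpa using h.head?_eq

end PathEq

/-- Paths `l` and `l'` that become equal after going on to `v`, by at most one move at the end. -/
def Coterminal (Y : CubicalComplex V) (v : V) (l l' : List V) : Prop :=
  Y.PathEq l l' ∨ ∃ u w x t, Y.IsSquare v u w x ∧ Y.PathEq l (u :: x :: t) ∧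
    Y.PathEq l' (w :: x :: t)

lemma Coterminal.symm {v : V} {l l' : List V} (h : Y.Coterminal v l l') :
    Y.Coterminal v l' l := by
  rcases h with h | ⟨u, w, x, t, hs, h, h'⟩
  · exact .inl h.symm
  · exact .inr ⟨w, u, x, t, hs.symm, h', h⟩

section flag

variable (hflag : ∀ v, (Y.link v).IsFlag)
include hflag

/-- Both final squares contain the edge from `u₁` to `v`. By `ih` the two continuations at `u₁`
agree, and then so do the squares, or they differ by a third square at `u₁`. In that case the three
squares span a 3-cube, and its face at `v` not containing `u₁` is the single square needed. -/
lemma Coterminal.trans {v : V} {l l' l'' : List V}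
    (ih : ∀ u p p', (u :: p).length = l.length → Y.PathEq (u :: p) (u :: p') →
      Y.Coterminal u p p')
    (h : Y.Coterminal v l l') (h' : Y.Coterminal v l' l'') : Y.Coterminal v l l'' := by
  rcases h with h | ⟨u₀, u₁, x₀, t₀, hs, h₀, h₁⟩
  · rcases h' with h' | ⟨u, w, x, t, hs, h₁, h₂⟩
    · exact .inl (h.trans h')
    · exact .inr ⟨u, w, x, t, hs, h.trans h₁, h₂⟩
  rcases h' with h' | ⟨u₁', u₂, x₁, t₁, hs', h₁', h₂⟩
  · exact .inr ⟨u₀, u₁, x₀, t₀, hs, h₀, h'.symm.trans h₁⟩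
  have h₁₁ := h₁.symm.trans h₁'
  obtain rfl := h₁₁.head_eq
  have hlen : (u₁ :: x₀ :: t₀).length = l.length := by simp [h₀.length_eq]
  rcases ih _ _ _ hlen h₁₁ with h | ⟨y₀, y₁, z, r, hsq, hy₀, hy₁⟩
  · obtain rfl := h.head_eq
    obtain rfl := hs.symm.rotate.unique hs'.rotate
    exact .inl ((h₀.trans (h.cons _)).trans h₂.symm)
  · obtain rfl := hy₀.head_eq
    obtain rfl := hy₁.head_eq
    obtain ⟨z', ha, hb, hc⟩ := exists_three_cube (hflag u₁) hs.symm.rotate hs'.rotate hsq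
    exact .inr ⟨u₀, u₂, z', z :: r, ha,
      (h₀.trans (hy₀.cons _)).trans (.swap _ hb), (h₂.trans (hy₁.cons _)).trans (.swap _ hc)⟩

/-- Only transitivity has content, and it needs the statement for shorter paths: hence an induction
on the length around one on the generation of the equivalence. -/
lemma coterminal_of_pathEq {v : V} {l l' : List V} (h : Y.PathEq (v :: l) (v :: l')) :
    Y.Coterminal v l l' := by
  induction hn : l.length using Nat.strong_induction_on generalizing v l l' with
  | _ n ih =>
  suffices ∀ p p', Y.PathEq p p' → p.length = n + 1 → ∀ v l l', p = v :: l → p' = v :: l' →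
      Y.Coterminal v l l' from this _ _ h (by simp [hn]) _ _ _ rfl rfl
  intro p p' hp
  induction hp with
  | rel _ _ h =>
    rintro hlen v l l' rfl hl'
    cases h with
    | swap t hs =>
      obtain ⟨-, rfl⟩ := List.cons_eq_cons.1 hl'
      exact .inr ⟨_, _, _, t, hs, .refl _, .refl _⟩
    | cons _ h =>
      obtain ⟨-, rfl⟩ := List.cons_eq_cons.1 hl'
      exact .inl (.rel _ _ h)
  | refl => 
    rintro hlen v l l' rfl hl'
    obtain ⟨-, rfl⟩ := List.cons_eq_cons.1 hl'
    exact .inl (.refl _)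
  | symm p p' hp ih' =>
    rintro hlen v l l' rfl rfl
    exact (ih' (by rw [PathEq.length_eq hp, hlen]) _ _ _ rfl rfl).symm
  | trans p q p' hp hq ih₁ ih₂ =>
    rintro hlen v l l' rfl rfl
    obtain ⟨w, m, rfl⟩ : ∃ w m, q = w :: m := by
      cases q with
      | nil => simpa using PathEq.length_eq hp
      | cons w m => exact ⟨w, m, rfl⟩
    obtain rfl := PathEq.head_eq hp
    refine Coterminal.trans hflag (fun u r r' hr h => ?_) (ih₁ hlen _ _ _ rfl rfl)
      (ih₂ (by rw [← PathEq.length_eq hp, hlen]) _ _ _ rfl rfl)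
    exact ih r.length (by simp at hr hlen; omega) h rfl

/-- Cancellation of a common last vertex. -/
lemma PathEq.of_cons {v w : V} {l l' : List V}
    (h : Y.PathEq (v :: w :: l) (v :: w :: l')) : Y.PathEq (w :: l) (w :: l') := by
  rcases coterminal_of_pathEq hflag h with h | ⟨u, u', x, t, hs, h₁, h₂⟩
  · exact h
  · exact absurd (h₁.head_eq.symm.trans h₂.head_eq) hs.ne₁

lemma exists_square_of_pathEq {v u w : V} {l l' : List V} (huw : u ≠ w)
    (h : Y.PathEq (v :: u :: l) (v :: w :: l')) :
    ∃ x t, Y.IsSquare v u w x ∧ Y.PathEq (u :: l) (u :: x :: t) ∧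
      Y.PathEq (w :: l') (w :: x :: t) := by
  rcases coterminal_of_pathEq hflag h with h | ⟨u, u', x, t, hs, h₁, h₂⟩
  · exact absurd h.head_eq huw
  · obtain rfl := h₁.head_eq
    obtain rfl := h₂.head_eq
    exact ⟨x, t, hs, h₁, h₂⟩

end flag

/-! ### Reduced paths and following an edge. -/

/-- Edge paths from `v₀`, of which no equivalent path backtracks. -/
inductive Reduced (Y : CubicalComplex V) (v₀ : V) : List V → Prop
  | single : Reduced Y v₀ [v₀]
  | cons {w v : V} {l : List V} (hl : Reduced Y v₀ (v :: l)) (h : Y.graph.Adj v w)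
      (hw : ∀ t, ¬ Y.PathEq (v :: l) (v :: w :: t)) : Reduced Y v₀ (w :: v :: l)

namespace Reduced

variable {v₀ : V}

lemma tail {v w : V} {l : List V} (h : Y.Reduced v₀ (w :: v :: l)) : Y.Reduced v₀ (v :: l) := by
  cases h; assumption

lemma adj {v w : V} {l : List V} (h : Y.Reduced v₀ (w :: v :: l)) : Y.graph.Adj v w := by
  cases h; assumption

lemma not_pathEq {v w : V} {l : List V} (h : Y.Reduced v₀ (w :: v :: l)) (t : List V) :
    ¬ Y.PathEq (v :: l) (v :: w :: t) := by
  cases h with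
  | cons _ _ h => exact h t

variable (hflag : ∀ v, (Y.link v).IsFlag)
include hflag

/-- A backtracking of the new path, at `x` or at `w`, can be carried across the square to a
backtracking of the old one. -/
lemma of_swap {v u w x : V} {t : List V} (h : Y.IsSquare v u w x)
    (hl : Y.Reduced v₀ (v :: u :: x :: t)) : Y.Reduced v₀ (v :: w :: x :: t) := by
  refine .cons (.cons hl.tail.tail h.adj₄.symm fun r hr => ?_) h.adj₂.symm fun r hr => ?_
  · exact hl.not_pathEq (w :: r) ((hr.cons u).trans (.swap r h.rotate.symm))
  · obtain ⟨y, r', hy, h₁, -⟩ := exists_square_of_pathEq hflag h.ne₂.symm hr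
    obtain rfl := h.symm.rotate.symm.unique hy
    exact hl.tail.not_pathEq _ h₁

lemma of_move {l l' : List V} (h : Y.Move l l') :
    Y.Reduced v₀ l ↔ Y.Reduced v₀ l' := by
  induction h with
  | swap t h => exact ⟨of_swap hflag h, of_swap hflag h.symm⟩
  | cons v h ih =>
    rename_i l l'
    constructor
    · intro hl
      cases hl with
      | single => cases h
      | cons hl hadj hn =>
        rename_i w l
        cases l' with
        | nil => simpa using h.length_eq
        | cons w' l' =>
        obtain rfl : w = w' := by simpa using h.head?_eq
        exact .cons (ih.1 hl) hadj fun t ht => hn t (.trans (.rel _ _ h) ht)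
    · intro hl
      cases hl with
      | single => cases h
      | cons hl hadj hn =>
        rename_i w l'
        cases l with
        | nil => simpa using h.length_eq
        | cons w' l =>
        obtain rfl : w' = w := by simpa using h.head?_eq
        exact .cons (ih.2 hl) hadj fun t ht => hn t (.trans (.symm (.rel _ _ h)) ht)

lemma congr {l l' : List V} (h : Y.PathEq l l') : Y.Reduced v₀ l ↔ Y.Reduced v₀ l' := by
  induction h with
  | rel _ _ h => exact of_move hflag h
  | refl => rfl
  | symm _ _ _ ih => exact ih.symm
  | trans _ _ _ _ _ ih ih' => exact ih.trans ih'

end Reduced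

/-- The reduced paths `l` and `l'` differ by a last edge. -/
def Follows (Y : CubicalComplex V) (v w : V) (l l' : List V) : Prop :=
  Y.PathEq l' (w :: l) ∨ Y.PathEq l (v :: l')

lemma Follows.symm {v w : V} {l l' : List V} (h : Y.Follows v w l l') : Y.Follows w v l' l :=
  Or.symm h

lemma Follows.congr {v w : V} {l l' m m' : List V} (h : Y.Follows v w l l') (hl : Y.PathEq l m)
    (hl' : Y.PathEq l' m') : Y.Follows v w m m' := by
  rcases h with h | h
  · exact .inl (hl'.symm.trans (h.trans (hl.cons w)))
  · exact .inr (hl.symm.trans (h.trans (hl'.cons v)))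

section follows

variable {v₀ : V} (hflag : ∀ v, (Y.link v).IsFlag)
include hflag

/-- The edge is cancelled if an equivalent path arrives through it, and appended otherwise. -/
lemma exists_follows {v w : V} {l : List V} (hl : Y.Reduced v₀ (v :: l))
    (h : Y.graph.Adj v w) : ∃ l', Y.Reduced v₀ (w :: l') ∧ Y.Follows v w (v :: l) (w :: l') := by
  by_cases hw : ∃ t, Y.PathEq (v :: l) (v :: w :: t)
  · obtain ⟨t, ht⟩ := hw
    exact ⟨t, ((Reduced.congr hflag ht).1 hl).tail, .inr ht⟩
  · push Not at hw
    exact ⟨v :: l, .cons hl h hw, .inl (.refl _)⟩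

/-- Appending and cancelling exclude each other because the paths are reduced; two cancellations
agree by `PathEq.of_cons`. -/
lemma Follows.unique {v w : V} {l l₁ l₂ : List V}
    (h₁ : Y.Reduced v₀ (w :: l₁)) (h₂ : Y.Reduced v₀ (w :: l₂))
    (hf₁ : Y.Follows v w (v :: l) (w :: l₁)) (hf₂ : Y.Follows v w (v :: l) (w :: l₂)) :
    Y.PathEq (w :: l₁) (w :: l₂) := by
  rcases hf₁ with hf₁ | hf₁ <;> rcases hf₂ with hf₂ | hf₂
  · exact hf₁.trans hf₂.symm
  · exact absurd hf₂ (((Reduced.congr hflag hf₁).1 h₁).not_pathEq _)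
  · exact absurd hf₁ (((Reduced.congr hflag hf₂).1 h₂).not_pathEq _)
  · exact PathEq.of_cons hflag (hf₁.symm.trans hf₂)

/-- Trivial holonomy around squares. Each of the given edges appends or cancels; reducedness
excludes the mixed cases that would backtrack, and the others follow from a swap or from
`exists_square_of_pathEq`. -/
lemma Follows.square {v u w x : V} {l l₁ l₂ l₃ : List V} (hs : Y.IsSquare v u w x)
    (hl₂ : Y.Reduced v₀ (x :: l₂))
    (hl₃ : Y.Reduced v₀ (w :: l₃))
    (h₁ : Y.Follows v u (v :: l) (u :: l₁)) (h₂ : Y.Follows u x (u :: l₁) (x :: l₂))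
    (h₃ : Y.Follows v w (v :: l) (w :: l₃)) : Y.Follows w x (w :: l₃) (x :: l₂) := by
  have hu : Y.IsSquare u v x w := hs.rotate
  rcases h₁ with h₁ | h₁
  · rcases h₂ with h₂ | h₂
    · rcases h₃ with h₃ | h₃
      · exact .inl (((h₂.trans (h₁.cons x)).trans (.swap l hu.symm.rotate)).trans (h₃.symm.cons x))
      · exact absurd ((h₁.trans (h₃.cons u)).trans (.swap l₃ hu))
          (((Reduced.congr hflag h₂).1 hl₂).not_pathEq _)
    · obtain ⟨y, t, hy, hv, hx⟩ := exists_square_of_pathEq hflag hs.ne₂ (h₁.symm.trans h₂)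
      obtain rfl := hu.unique hy
      rcases h₃ with h₃ | h₃
      · exact absurd hv (((Reduced.congr hflag h₃).1 hl₃).not_pathEq _)
      · exact .inl (hx.trans ((PathEq.of_cons hflag (hv.symm.trans h₃)).cons x))
  · rcases h₃ with h₃ | h₃
    · rcases h₂ with h₂ | h₂
      · exact .inr (((h₃.trans (h₁.cons w)).trans (.swap l₁ hs.symm.rotate)).trans
          (h₂.symm.cons w))
      · exact absurd ((h₁.trans (h₂.cons v)).trans (.swap l₂ hs))
          (((Reduced.congr hflag h₃).1 hl₃).not_pathEq _)
    · obtain ⟨y, t, hy, hu', hw⟩ := exists_square_of_pathEq hflag hs.ne₁ (h₁.symm.trans h₃)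
      obtain rfl := hs.unique hy
      rcases h₂ with h₂ | h₂
      · exact absurd hu' (((Reduced.congr hflag h₂).1 hl₂).not_pathEq _)
      · exact .inr (hw.trans ((PathEq.of_cons hflag (hu'.symm.trans h₂)).cons w))

end follows
end CubicalComplex

/-! ### The realization, open stars and connectedness. -/

/-- Lifting through coverings needs a locally path connected base; the realization inherits this as
a quotient of a disjoint union of powers of the interval. -/
instance : LocallyPathConnectedSpace unitInterval :=
  (isQuotientMap_projIcc (h := zero_le_one (α := ℝ))).locallyPathConnectedSpace

namespace CubicalComplex

variable {V : Type*} {Y : CubicalComplex V}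

namespace Chart

variable (c : Y.Chart)

lemma vertexCoord_vert (x : Fin c.dim → unitInterval) (b : Fin c.dim → Bool) :
    c.vertexCoord x (c.vert b) = ∏ i, if b i = true then (x i : ℝ) else 1 - (x i : ℝ) :=
  c.isChart.injective.extend_apply _ _ _

lemma vertexCoord_of_notMem (x : Fin c.dim → unitInterval) {v : V} (hv : v ∉ Set.range c.vert) :
    c.vertexCoord x v = 0 :=
  extend_apply' _ _ _ hv

lemma continuous_vertexCoord (v : V) : Continuous fun x => c.vertexCoord x v := by
  by_cases hv : v ∈ Set.range c.vert
  · obtain ⟨b, rfl⟩ := hv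
    simp only [vertexCoord_vert]
    refine continuous_finsetProd _ fun i _ => ?_
    split_ifs <;> fun_prop
  · simp only [vertexCoord_of_notMem c _ hv]
    exact continuous_const

end Chart

instance : LocallyPathConnectedSpace Y.Realization :=
  inferInstanceAs (LocallyPathConnectedSpace (Quotient Y.gluing))

/-- The point of the realization with coordinates `x` in a parametrized cube. -/
noncomputable def toRealization (c : Y.Chart) (x : Fin c.dim → unitInterval) : Y.Realization :=
  Quotient.mk Y.gluing ⟨c, x⟩

lemma continuous_toRealization (c : Y.Chart) : Continuous (toRealization c) :=
  continuous_quotient_mk'.comp (continuous_sigmaMk (i := c))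

lemma exists_toRealization (p : Y.Realization) : ∃ c x, toRealization (Y := Y) c x = p := by
  obtain ⟨⟨c, x⟩, rfl⟩ := Quotient.exists_rep p
  exact ⟨c, x, rfl⟩

/-- The coordinate of a point of the realization at the vertex `v`. -/
noncomputable def coord (v : V) : Y.Realization → ℝ :=
  Quotient.lift (fun p => p.1.vertexCoord p.2 v) fun _ _ h => congrFun h v

@[simp] lemma coord_toRealization (v : V) (c : Y.Chart) (x : Fin c.dim → unitInterval) :
    coord v (toRealization c x) = c.vertexCoord x v := rfl

lemma continuous_coord (v : V) : Continuous (coord (Y := Y) v) :=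
  Continuous.quotient_lift (continuous_sigma fun c => c.continuous_vertexCoord v) _

variable (Y) in
/-- The open star of a vertex. -/
def openStar (v : V) : Set Y.Realization := {p | 0 < coord v p}

lemma isOpen_openStar (v : V) : IsOpen (Y.openStar v) :=
  isOpen_lt continuous_const (continuous_coord v)

lemma exists_mem_openStar (p : Y.Realization) : ∃ v, p ∈ Y.openStar v := by
  obtain ⟨c, x, rfl⟩ := exists_toRealization p
  -- Rounding every nonzero coordinate up to 1 keeps all factors of the product positive.
  refine ⟨c.vert fun i => decide (x i ≠ 0), ?_⟩
  simp only [openStar, Set.mem_ofPred_eq, coord_toRealization, Chart.vertexCoord_vert]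
  refine Finset.prod_pos fun i _ => ?_
  by_cases h : x i = 0
  · simp [h]
  · simpa [h] using unitInterval.pos_iff_ne_zero.2 h

/-- The vertices whose open stars contain a given point lie in a common cube. -/
lemma exists_cube_of_openStar (p : Y.Realization) :
    ∃ C ∈ Y.cubes, ∀ v, p ∈ Y.openStar v → v ∈ C := by
  obtain ⟨c, x, rfl⟩ := exists_toRealization p
  refine ⟨_, range_mem c.isChart, fun v hv => ?_⟩
  by_contra h
  simp [openStar, c.vertexCoord_of_notMem x h] at hv

/-- The midpoint of the unit interval. -/
noncomputable def midpoint : unitInterval := ⟨1 / 2, by norm_num, by norm_num⟩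

/-- A path from a vertex of a cube to the centre of that cube. -/
noncomputable def toCentre (c : Y.Chart) (b : Fin c.dim → Bool) (t : unitInterval) :
    Y.Realization :=
  toRealization c fun i => if b i then unitInterval.symm (midpoint * t) else midpoint * t

lemma continuous_toCentre (c : Y.Chart) (b : Fin c.dim → Bool) : Continuous (toCentre c b) := by
  refine (continuous_toRealization c).comp (continuous_pi fun i => ?_)
  split_ifs <;> fun_prop

lemma toCentre_mem_openStar (c : Y.Chart) (b : Fin c.dim → Bool) (t : unitInterval) :
    toCentre c b t ∈ Y.openStar (c.vert b) := by
  simp only [openStar, Set.mem_ofPred_eq, toCentre, coord_toRealization, Chart.vertexCoord_vert]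
  refine Finset.prod_pos fun i _ => ?_
  have h1 := t.2.1
  have h2 := t.2.2
  cases b i <;> simp [midpoint] <;> linarith

lemma toCentre_one (c : Y.Chart) (b b' : Fin c.dim → Bool) : toCentre c b 1 = toCentre c b' 1 := by
  have : unitInterval.symm midpoint = midpoint := by ext; norm_num [midpoint]
  simp [toCentre, this]

lemma eq_of_coord_eq {p q : Y.Realization} (h : ∀ v, coord v p = coord v q) : p = q := by
  obtain ⟨c, x, rfl⟩ := exists_toRealization p
  obtain ⟨c', x', rfl⟩ := exists_toRealization q
  exact Quotient.sound (funext h)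

lemma coord_toCentre_zero (c : Y.Chart) (b : Fin c.dim → Bool) (v : V) [Decidable (v = c.vert b)] :
    coord v (toCentre c b 0) = if v = c.vert b then 1 else 0 := by
  rw [toCentre, coord_toRealization]
  by_cases hv : v ∈ Set.range c.vert
  · obtain ⟨b', rfl⟩ := hv
    rw [Chart.vertexCoord_vert]
    split_ifs with h
    · obtain rfl := c.isChart.injective h
      refine Finset.prod_eq_one fun i _ => ?_
      cases b' i <;> simp
    · obtain ⟨i, hi⟩ := Function.ne_iff.1 fun h' : b' = b => h (by rw [h'])
      refine Finset.prod_eq_zero (Finset.mem_univ i) ?_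
      cases h1 : b i <;> cases h2 : b' i <;> simp_all
  · rw [c.vertexCoord_of_notMem _ hv, if_neg]
    rintro rfl
    exact hv ⟨b, rfl⟩

lemma exists_chart_vert (Y : CubicalComplex V) {C : Set V} (hC : C ∈ Y.cubes) :
    ∃ c : Y.Chart, Set.range c.vert = C := by
  obtain ⟨n, e, he, rfl⟩ := Y.exists_chart C hC
  exact ⟨⟨n, e, he⟩, rfl⟩

lemma toCentre_zero_eq {c c' : Y.Chart} {b : Fin c.dim → Bool} {b' : Fin c'.dim → Bool}
    (h : c.vert b = c'.vert b') : toCentre c b 0 = toCentre c' b' 0 := by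
  classical
  exact eq_of_coord_eq fun v => by rw [coord_toCentre_zero, coord_toCentre_zero, h]

section connected

/-- The `1`-skeleton of a connected cubical complex is connected. -/
lemma graph_induction [PreconnectedSpace Y.Realization] {P : V → Prop} {v₀ : V} (h₀ : P v₀)
    (h : ∀ v w, Y.graph.Adj v w → P v → P w) (v : V) : P v := by
  by_contra hv
  have hstar : ∀ w, (Y.openStar w).Nonempty := fun w => by
    obtain ⟨c, hc⟩ := Y.exists_chart_vert (Y.vertex_mem w)
    obtain ⟨b, hb⟩ : w ∈ Set.range c.vert := by simp [hc]
    exact ⟨_, hb ▸ toCentre_mem_openStar c b 0⟩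
  have hcube : ∀ C ∈ Y.cubes, ∀ x ∈ C, ∀ y ∈ C, P x → P y := by
    rintro C hC x hx y hy hPx
    obtain ⟨n, e, he, rfl⟩ := Y.exists_chart C hC
    obtain ⟨x, rfl⟩ := hx
    obtain ⟨y, rfl⟩ := hy
    exact flipAt_induction (P := fun b => P (e b)) x hPx (fun b i => h _ _ (adj_flipAt he b i)) y
  -- The stars of the vertices with and without `P` form two open sets covering the space; a common
  -- point would put two such vertices in one cube, against `hcube`.
  obtain ⟨p, -, hp₁, hp₂⟩ := isPreconnected_univ (α := Y.Realization)
    (⋃ w ∈ {w | P w}, Y.openStar w) (⋃ w ∈ {w | ¬ P w}, Y.openStar w)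
    (isOpen_biUnion fun w _ => isOpen_openStar w) (isOpen_biUnion fun w _ => isOpen_openStar w)
    (fun p _ => by
      obtain ⟨w, hw⟩ := exists_mem_openStar p
      by_cases hPw : P w
      · exact .inl (Set.mem_biUnion hPw hw)
      · exact .inr (Set.mem_biUnion hPw hw))
    (by
      obtain ⟨p, hp⟩ := hstar v₀
      exact ⟨p, trivial, Set.mem_biUnion h₀ hp⟩)
    (by
      obtain ⟨p, hp⟩ := hstar v
      exact ⟨p, trivial, Set.mem_biUnion hv hp⟩)
  simp only [Set.mem_iUnion, Set.mem_ofPred_eq, exists_prop] at hp₁ hp₂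
  obtain ⟨x, hx, hpx⟩ := hp₁
  obtain ⟨y, hy, hpy⟩ := hp₂
  obtain ⟨C, hC, h⟩ := exists_cube_of_openStar p
  exact hy (hcube C hC x (h x hpx) y (h y hpy) hx)

end connected

/-! ### Coverings from cocycles. -/

section bundle

variable {F : Type*} [TopologicalSpace F] [DiscreteTopology F]

/-- The covering of the realization with fibre `F` and locally constant transition functions `g`
between the open stars of the vertices. -/
noncomputable def bundleCore (Y : CubicalComplex V) (g : V → V → F → F)
    (h_self : ∀ v s, g v v s = s)
    (h_comp : ∀ C ∈ Y.cubes, ∀ u ∈ C, ∀ v ∈ C, ∀ w ∈ C, ∀ s, g v w (g u v s) = g u w s) :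
    FiberBundleCore V Y.Realization F where
  baseSet := Y.openStar
  isOpen_baseSet := isOpen_openStar
  indexAt p := (exists_mem_openStar p).choose
  mem_baseSet_at p := (exists_mem_openStar p).choose_spec
  coordChange v w _ s := g v w s
  coordChange_self v _ _ s := h_self v s
  continuousOn_coordChange v w :=
    ((continuous_of_discreteTopology (f := g v w)).comp continuous_snd).continuousOn
  coordChange_comp u v w p hp s := by
    obtain ⟨C, hC, h⟩ := exists_cube_of_openStar p
    exact h_comp C hC u (h u hp.1.1) v (h v hp.1.2) w (h w hp.2) s

/-- A covering with transition functions `g` of a simply connected complex has a section. -/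
theorem exists_section_of_cocycle [SimplyConnectedSpace Y.Realization] (g : V → V → F → F)
    (h_self : ∀ v s, g v v s = s)
    (h_comp : ∀ C ∈ Y.cubes, ∀ u ∈ C, ∀ v ∈ C, ∀ w ∈ C, ∀ s, g v w (g u v s) = g u w s)
    (v₀ : V) (s₀ : F) :
    ∃ f : V → F, f v₀ = s₀ ∧ ∀ C ∈ Y.cubes, ∀ v ∈ C, ∀ w ∈ C, f w = g v w (f v) := by
  let Z := Y.bundleCore g h_self h_comp
  have hcov : IsCoveringMap (Bundle.TotalSpace.proj : Bundle.TotalSpace F Z.Fiber → _) :=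
    FiberBundle.isCoveringMap
  have hvert : ∀ v, ∃ p : Y.Realization, ∀ (c : Y.Chart) (b : Fin c.dim → Bool), c.vert b = v →
      toCentre c b 0 = p := fun v => by
    obtain ⟨c, hc⟩ := Y.exists_chart_vert (Y.vertex_mem v)
    obtain ⟨b, hb⟩ : v ∈ Set.range c.vert := by simp [hc]
    exact ⟨toCentre c b 0, fun c' b' h => toCentre_zero_eq (h.trans hb.symm)⟩
  choose pt hpt using hvert
  have hmem : ∀ v, pt v ∈ Y.openStar v := fun v => by
    obtain ⟨c, hc⟩ := Y.exists_chart_vert (Y.vertex_mem v)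
    obtain ⟨b, hb⟩ : v ∈ Set.range c.vert := by simp [hc]
    rw [← hpt v c b hb, ← hb]
    exact toCentre_mem_openStar c b 0
  -- A lift of the identity is a global section of the covering.
  obtain ⟨S, ⟨hS₀, hS⟩, -⟩ := hcov.existsUnique_continuousMap_lifts (ContinuousMap.id _) (pt v₀)
    ((Z.localTriv v₀).toOpenPartialHomeomorph.symm (pt v₀, s₀)) rfl
  have hproj : ∀ p, (S p).proj = p := fun p => congrFun hS p
  have hbase : ∀ p v, p ∈ Y.openStar v → S p ∈ (Z.localTriv v).source := fun p v hp => by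
    rw [FiberBundleCore.mem_localTriv_source, hproj]
    exact hp
  have htriv : ∀ p v w, p ∈ Y.openStar v → p ∈ Y.openStar w →
      (Z.localTriv w (S p)).2 = g v w (Z.localTriv v (S p)).2 := fun p v w hv hw => by
    have := Z.coordChange_comp (Z.indexAt (S p).proj) v w (S p).proj
      ⟨⟨Z.mem_baseSet_at _, by rw [hproj]; exact hv⟩, by rw [hproj]; exact hw⟩ (S p).2
    exact this.symm
  refine ⟨fun v => (Z.localTriv v (S (pt v))).2, ?_, ?_⟩
  · show (Z.localTriv v₀ (S (pt v₀))).2 = s₀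
    rw [hS₀]
    have := (Z.localTriv v₀).toOpenPartialHomeomorph.right_inv (x := (pt v₀, s₀))
      ((Z.mem_localTriv_target _ _).2 (hmem v₀))
    exact congrArg Prod.snd this
  · intro C hC v hv w hw
    obtain ⟨c, rfl⟩ := Y.exists_chart_vert hC
    obtain ⟨b, rfl⟩ := hv
    obtain ⟨b', rfl⟩ := hw
    -- The segment from a vertex to the centre stays in the open star of that vertex, where the
    -- discrete coordinate of `S` is constant. At the centre the stars of all vertices of the cube
    -- overlap, so their coordinates can be compared.
    have key : ∀ b, (Z.localTriv (c.vert b) (S (pt (c.vert b)))).2 =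
        (Z.localTriv (c.vert b) (S (toCentre c b 1))).2 := fun b => by
      rw [← hpt _ c b rfl]
      have hcont : Continuous fun t : unitInterval =>
          (Z.localTriv (c.vert b) (S (toCentre c b t))).2 := by
        refine continuous_snd.comp ?_
        refine (Z.localTriv (c.vert b)).continuousOn.comp_continuous
          (S.continuous.comp (continuous_toCentre c b)) fun t => ?_
        exact hbase _ _ (toCentre_mem_openStar c b t)
      exact PreconnectedSpace.constant inferInstance hcont
    show (Z.localTriv _ _).2 = g _ _ (Z.localTriv _ _).2
    rw [key b, key b', toCentre_one c b b']
    exact htriv _ _ _ (toCentre_one c b b' ▸ toCentre_mem_openStar c b 1)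
      (toCentre_mem_openStar c b' 1)

end bundle
end CubicalComplex

/-! ### Local systems and their sections. -/

lemma flipAt_cons_zero {n : ℕ} (a : Bool) (t : Fin n → Bool) :
    flipAt (Fin.cons a t : Fin (n + 1) → Bool) 0 = Fin.cons (!a) t := by
  simp [flipAt]

lemma flipAt_cons_succ {n : ℕ} (a : Bool) (t : Fin n → Bool) (i : Fin n) :
    flipAt (Fin.cons a t : Fin (n + 1) → Bool) i.succ = Fin.cons a (flipAt t i) := by
  simp [flipAt, Fin.cons_update]

namespace CubicalComplex

variable {V : Type*}

/-- A local system on a cubical complex, with fibres that are subsets of `Q`: bijections between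
the fibres along the edges that commute around the squares. -/
structure LocalSystem (Y : CubicalComplex V) (Q : Type*) where
  fibre : V → Set Q
  map : V → V → Q → Q
  mapsTo : ∀ {v w s}, Y.graph.Adj v w → s ∈ fibre v → map v w s ∈ fibre w
  map_map : ∀ {v w s}, Y.graph.Adj v w → s ∈ fibre v → map w v (map v w s) = s
  square : ∀ {v u w x s}, Y.IsSquare v u w x → s ∈ fibre v →
    map u x (map v u s) = map w x (map v w s)

namespace LocalSystem

variable {Y : CubicalComplex V} {Q : Type*} (L : Y.LocalSystem Q)

/-- By induction on the dimension, `φ` exists on the facet through `b₀` and is carried across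
direction `0`. Compatibility with the other directions on the opposite facet is the square
condition. -/
lemma exists_parallel_chart {n : ℕ} (e : (Fin n → Bool) → V)
    (hadj : ∀ b i, Y.graph.Adj (e b) (e (flipAt b i)))
    (hsq : ∀ b i j, i ≠ j →
      Y.IsSquare (e b) (e (flipAt b i)) (e (flipAt b j)) (e (flipAt (flipAt b i) j)))
    (b₀ : Fin n → Bool) {s : Q} (hs : s ∈ L.fibre (e b₀)) :
    ∃ φ : (Fin n → Bool) → Q, φ b₀ = s ∧ (∀ b, φ b ∈ L.fibre (e b)) ∧
      ∀ b i, φ (flipAt b i) = L.map (e b) (e (flipAt b i)) (φ b) := by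
  induction n with
  | zero =>
    exact ⟨fun _ => s, rfl, fun b => by rwa [Subsingleton.elim b b₀], fun b i => i.elim0⟩
  | succ n ih =>
    obtain ⟨a₀, t₀, rfl⟩ : ∃ a t, b₀ = (Fin.cons a t : Fin (n + 1) → Bool) :=
      ⟨_, _, (Fin.cons_self_tail b₀).symm⟩
    obtain ⟨φ, hφ₀, hφ, hφ'⟩ := ih (fun t => e (Fin.cons a₀ t))
      (fun t i => by simpa only [flipAt_cons_succ] using hadj (Fin.cons a₀ t) i.succ)
      (fun t i j hij => by
        simpa only [flipAt_cons_succ] using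
          hsq (Fin.cons a₀ t) i.succ j.succ (fun h => hij (Fin.succ_injective _ h))) t₀ hs
    have hadj₀ : ∀ t, Y.graph.Adj (e (Fin.cons a₀ t)) (e (Fin.cons (!a₀) t)) := fun t => by
      simpa only [flipAt_cons_zero] using hadj (Fin.cons a₀ t) 0
    let ψ : (Fin (n + 1) → Bool) → Q := fun b => if b 0 = a₀ then φ (Fin.tail b) else
      L.map (e (Fin.cons a₀ (Fin.tail b))) (e b) (φ (Fin.tail b))
    have h₁ : ∀ t, ψ (Fin.cons a₀ t) = φ t := fun t => by simp [ψ]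
    have h₂ : ∀ t, ψ (Fin.cons (!a₀) t) =
        L.map (e (Fin.cons a₀ t)) (e (Fin.cons (!a₀) t)) (φ t) := fun t => by simp [ψ]
    have hcases : ∀ b : Fin (n + 1) → Bool, ∃ t, b = Fin.cons a₀ t ∨ b = Fin.cons (!a₀) t := by
      intro b
      refine ⟨Fin.tail b, ?_⟩
      rcases Bool.eq_or_eq_not (b 0) a₀ with h | h
      · left; rw [← h, Fin.cons_self_tail]
      · right; rw [← h, Fin.cons_self_tail]
    refine ⟨ψ, by rw [h₁, hφ₀], fun b => ?_, fun b i => ?_⟩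
    · obtain ⟨t, rfl | rfl⟩ := hcases b
      · rw [h₁]; exact hφ t
      · rw [h₂]; exact L.mapsTo (hadj₀ t) (hφ t)
    · obtain ⟨t, rfl | rfl⟩ := hcases b
      · cases i using Fin.cases with
        | zero => rw [flipAt_cons_zero, h₁, h₂]
        | succ j => rw [flipAt_cons_succ, h₁, h₁, hφ']
      · cases i using Fin.cases with
        | zero => rw [flipAt_cons_zero, Bool.not_not, h₁, h₂, L.map_map (hadj₀ t) (hφ t)]
        | succ j =>
          have := hsq (Fin.cons a₀ t) 0 j.succ (Fin.succ_ne_zero j).symm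
          rw [flipAt_cons_zero, flipAt_cons_succ, flipAt_cons_succ] at this
          rw [flipAt_cons_succ, h₂, h₂, hφ', L.square this (hφ t)]

/-- A family of elements of the fibres over a set of vertices that is invariant along the edges. -/
def IsParallel (C : Set V) (φ : V → Q) : Prop :=
  (∀ x ∈ C, φ x ∈ L.fibre x) ∧ ∀ x ∈ C, ∀ y ∈ C, Y.graph.Adj x y → φ y = L.map x y (φ x)

variable {L}

lemma exists_isParallel {C : Set V} (hC : C ∈ Y.cubes) {v : V} (hv : v ∈ C) {s : Q}
    (hs : s ∈ L.fibre v) : ∃ φ, L.IsParallel C φ ∧ φ v = s := by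
  obtain ⟨n, e, he, rfl⟩ := Y.exists_chart C hC
  obtain ⟨b, rfl⟩ := hv
  obtain ⟨φ, hφ₀, hφ, hφ'⟩ := L.exists_parallel_chart e (adj_flipAt he)
    (fun b i j => isSquare_flipAt he b) b hs
  have hext : ∀ b, extend e φ (fun _ => s) (e b) = φ b := fun b => he.injective.extend_apply _ _ _
  refine ⟨extend e φ fun _ => s, ⟨?_, ?_⟩, by rw [hext, hφ₀]⟩
  · rintro _ ⟨x, rfl⟩
    rw [hext]; exact hφ x
  · rintro _ ⟨x, rfl⟩ _ ⟨y, rfl⟩ hxy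
    obtain ⟨i, rfl⟩ := (adj_iff he).1 hxy
    rw [hext, hext, hφ']

lemma IsParallel.mono {C D : Set V} {φ : V → Q} (h : L.IsParallel C φ) (hD : D ⊆ C) :
    L.IsParallel D φ :=
  ⟨fun x hx => h.1 x (hD hx), fun x hx y hy => h.2 x (hD hx) y (hD hy)⟩

/-- The intersection is a cube, hence connected, so agreement spreads from `v`. Thus transport
inside a cube does not depend on the cube. -/
lemma IsParallel.eq {C D : Set V} (hC : C ∈ Y.cubes) (hD : D ∈ Y.cubes) {φ ψ : V → Q}
    (hφ : L.IsParallel C φ) (hψ : L.IsParallel D ψ) {v w : V} (hv : v ∈ C ∩ D) (hw : w ∈ C ∩ D)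
    (h : φ v = ψ v) : φ w = ψ w := by
  have hφ' := hφ.mono (Set.inter_subset_left (t := D))
  have hψ' := hψ.mono (Set.inter_subset_right (s := C))
  obtain ⟨n, e, he, hr⟩ := Y.exists_chart _ (Y.inter_mem C hC D hD ⟨v, hv⟩)
  rw [← hr] at hv hw hφ' hψ'
  obtain ⟨b, rfl⟩ := hv
  obtain ⟨b', rfl⟩ := hw
  refine flipAt_induction (P := fun b => φ (e b) = ψ (e b)) b h (fun b i hb => ?_) b'
  rw [hφ'.2 _ ⟨b, rfl⟩ _ ⟨_, rfl⟩ (adj_flipAt he b i),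
    hψ'.2 _ ⟨b, rfl⟩ _ ⟨_, rfl⟩ (adj_flipAt he b i), hb]

/-- The bijection between the fibres along an edge. -/
def fibreEquiv {v w : V} (h : Y.graph.Adj v w) : L.fibre v ≃ L.fibre w where
  toFun s := ⟨L.map v w s, L.mapsTo h s.2⟩
  invFun s := ⟨L.map w v s, L.mapsTo h.symm s.2⟩
  left_inv s := Subtype.ext (L.map_map h s.2)
  right_inv s := Subtype.ext (L.map_map h.symm s.2)

/-- A local system on a simply connected cubical complex has a section through every element. -/
theorem exists_section [SimplyConnectedSpace Y.Realization] {v₀ : V} {s₀ : Q}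
    (hs₀ : s₀ ∈ L.fibre v₀) :
    ∃ σ : V → Q, σ v₀ = s₀ ∧ (∀ v, σ v ∈ L.fibre v) ∧
      ∀ v w, Y.graph.Adj v w → σ w = L.map v w (σ v) := by
  -- The bundle needs one model fibre. These identifications are arbitrary; the transition functions
  -- absorb the choice.
  have hE : ∀ v, Nonempty (L.fibre v ≃ L.fibre v₀) :=
    graph_induction (v₀ := v₀) ⟨Equiv.refl _⟩ fun v w h ⟨E⟩ => ⟨(L.fibreEquiv h).symm.trans E⟩
  have E : ∀ v, L.fibre v ≃ L.fibre v₀ := fun v => (hE v).some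
  have hτ : ∀ v w (s : L.fibre v), ∃ t : L.fibre w, ∀ C ∈ Y.cubes, ∀ φ, L.IsParallel C φ →
      v ∈ C → w ∈ C → φ v = s → φ w = t := by
    intro v w s
    by_cases h : ∃ C ∈ Y.cubes, v ∈ C ∧ w ∈ C
    · obtain ⟨C, hC, hv, hw⟩ := h
      obtain ⟨φ, hφ, hφs⟩ := exists_isParallel hC hv s.2
      exact ⟨⟨φ w, hφ.1 w hw⟩, fun D hD ψ hψ hv' hw' hψs =>
        hψ.eq hD hC hφ ⟨hv', hv⟩ ⟨hw', hw⟩ (hψs.trans hφs.symm)⟩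
    -- A junk value: the cocycle matters only for vertices of a common cube.
    · exact ⟨(E w).symm (E v s), fun C hC _ _ hv hw => absurd ⟨C, hC, hv, hw⟩ h⟩
  choose τ hτ using hτ
  let _ : TopologicalSpace (L.fibre v₀) := ⊥
  have : DiscreteTopology (L.fibre v₀) := ⟨rfl⟩
  obtain ⟨f, hf₀, hf⟩ := exists_section_of_cocycle (Y := Y)
    (fun v w s => E w (τ v w ((E v).symm s)))
    (fun v s => by
      obtain ⟨φ, hφ, hφs⟩ := exists_isParallel (Y.vertex_mem v) rfl ((E v).symm s).2
      have h := hτ v v ((E v).symm s) _ (Y.vertex_mem v) φ hφ rfl rfl hφs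
      rw [hφs] at h
      rw [← Subtype.ext h, Equiv.apply_symm_apply])
    (fun C hC u hu v hv w hw s => by
      obtain ⟨φ, hφ, hφs⟩ := exists_isParallel hC hu ((E u).symm s).2
      have h₁ := hτ u v _ _ hC φ hφ hu hv hφs
      have h₂ := hτ u w _ _ hC φ hφ hu hw hφs
      have h₃ := hτ v w (τ u v ((E u).symm s)) _ hC φ hφ hv hw h₁
      rw [Equiv.symm_apply_apply, Subtype.ext (h₃.symm.trans h₂)])
    v₀ (E v₀ ⟨s₀, hs₀⟩)
  refine ⟨fun v => (E v).symm (f v), by simp [hf₀], fun v => ((E v).symm (f v)).2, ?_⟩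
  intro v w h
  obtain ⟨φ, hφ, hφs⟩ := exists_isParallel h.2 (Set.mem_insert v {w}) ((E v).symm (f v)).2
  have hw : w ∈ ({v, w} : Set V) := by simp
  have h₁ := hτ v w _ _ h.2 φ hφ (by simp) hw hφs
  show ((E w).symm (f w) : Q) = _
  rw [hf _ h.2 v (by simp) w hw, Equiv.symm_apply_apply, ← h₁,
    hφ.2 v (by simp) w hw h, hφs]

end LocalSystem
end CubicalComplex

/-! ### Reduced paths as a local system; the quadrangle condition. -/

namespace CubicalComplex

variable {V : Type*} {Y : CubicalComplex V}

section reducedPaths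

variable (hflag : ∀ v, (Y.link v).IsFlag)

open Classical in
/-- Follow an edge on classes of reduced paths. -/
noncomputable def followEdge (Y : CubicalComplex V) (v₀ v w : V) (q : Quot Y.Move) : Quot Y.Move :=
  -- The `else` value is junk: for classes of reduced paths ending at `v` and an edge `vw`, the
  -- condition holds by `exists_follows`.
  if h : ∃ l l', q = Quot.mk _ (v :: l) ∧ Y.Reduced v₀ (w :: l') ∧
    Y.Follows v w (v :: l) (w :: l') then Quot.mk _ (w :: h.choose_spec.choose) else q

include hflag

lemma followEdge_mk {v₀ v w : V} {l l' : List V}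
    (hl' : Y.Reduced v₀ (w :: l')) (h : Y.Follows v w (v :: l) (w :: l')) :
    followEdge Y v₀ v w (Quot.mk _ (v :: l)) = Quot.mk _ (w :: l') := by
  have hex : ∃ m m', Quot.mk Y.Move (v :: l) = Quot.mk _ (v :: m) ∧ Y.Reduced v₀ (w :: m') ∧
    Y.Follows v w (v :: m) (w :: m') := ⟨l, l', rfl, hl', h⟩
  rw [followEdge, dif_pos hex]
  obtain ⟨h₁, h₂, h₃⟩ := hex.choose_spec.choose_spec
  exact Quot.eq.2 (Follows.unique hflag h₂ hl'
    (h₃.congr (Quot.eq.1 h₁.symm) (.refl _)) h)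

/-- The reduced paths from a base vertex, as a local system. -/
noncomputable def reducedPaths (v₀ : V) : Y.LocalSystem (Quot Y.Move) where
  fibre v := {q | ∃ l, Y.Reduced v₀ (v :: l) ∧ q = Quot.mk _ (v :: l)}
  map := followEdge Y v₀
  mapsTo := by
    rintro v w _ h ⟨l, hl, rfl⟩
    obtain ⟨l', hl', hf⟩ := exists_follows hflag hl h
    exact ⟨l', hl', followEdge_mk hflag hl' hf⟩
  map_map := by
    rintro v w _ h ⟨l, hl, rfl⟩
    obtain ⟨l', hl', hf⟩ := exists_follows hflag hl h
    rw [followEdge_mk hflag hl' hf, followEdge_mk hflag hl hf.symm]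
  square := by
    rintro v u w x _ hs ⟨l, hl, rfl⟩
    obtain ⟨l₁, hl₁, h₁⟩ := exists_follows hflag hl hs.adj₁
    obtain ⟨l₂, hl₂, h₂⟩ := exists_follows hflag hl₁ hs.adj₃
    obtain ⟨l₃, hl₃, h₃⟩ := exists_follows hflag hl hs.adj₂
    rw [followEdge_mk hflag hl₁ h₁, followEdge_mk hflag hl₂ h₂, followEdge_mk hflag hl₃ h₃,
      followEdge_mk hflag hl₂ (Follows.square hflag hs hl₂ hl₃ h₁ h₂ h₃)]

variable [SimplyConnectedSpace Y.Realization]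

/-- In a simply connected complex with flag links there is only one class of reduced paths between
two vertices. -/
theorem exists_reduced_section (v₀ : V) :
    ∃ l : V → List V, l v₀ = [] ∧ (∀ v, Y.Reduced v₀ (v :: l v)) ∧
      ∀ v w, Y.graph.Adj v w → Y.Follows v w (v :: l v) (w :: l w) := by
  obtain ⟨σ, hσ₀, hσ, hσ'⟩ := LocalSystem.exists_section (L := reducedPaths hflag v₀) (v₀ := v₀)
    (s₀ := Quot.mk _ [v₀]) ⟨[], .single, rfl⟩
  choose l hl hσl using hσ
  refine ⟨l, ?_, hl, fun v w h => ?_⟩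
  · rw [hσl] at hσ₀
    have := PathEq.length_eq (Quot.eq.1 hσ₀)
    simpa using this
  · obtain ⟨l', hl', hf⟩ := exists_follows hflag (hl v) h
    have := hσ' v w h
    rw [hσl v, hσl w] at this
    have h' : Y.PathEq _ _ := Quot.eq.1 (this.trans (followEdge_mk hflag hl' hf))
    exact hf.congr (.refl _) h'.symm

/-- The height is the length of the path picked by the section. Two descending edges at `v` give two
equivalent paths to `v`, which by `exists_square_of_pathEq` close up to a square. -/
theorem exists_height (v₀ : V) :
    ∃ n : V → ℕ, n v₀ = 0 ∧ (∀ v, n v = 0 → v = v₀) ∧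
      (∀ v w, Y.graph.Adj v w → n w = n v + 1 ∨ n v = n w + 1) ∧
      (∀ v, n v ≠ 0 → ∃ w, Y.graph.Adj v w ∧ n v = n w + 1) ∧
      ∀ v u w, Y.graph.Adj v u → Y.graph.Adj v w → u ≠ w → n v = n u + 1 → n v = n w + 1 →
        ∃ x, Y.IsSquare v u w x ∧ n u = n x + 1 := by
  obtain ⟨l, hl₀, hl, hf⟩ := exists_reduced_section hflag v₀
  -- The truncated path is reduced and follows from the path at `v`, so by uniqueness it is
  -- equivalent to the chosen one at `u`.
  have hdown : ∀ v u t, Y.PathEq (v :: l v) (v :: u :: t) →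
      Y.graph.Adj v u ∧ (l v).length = (l u).length + 1 := by
    intro v u t h
    have hr := (Reduced.congr hflag h).1 (hl v)
    refine ⟨hr.adj.symm, ?_⟩
    have := Follows.unique hflag hr.tail (hl u) (.inr h) (hf v u hr.adj.symm)
    have h₁ := this.length_eq
    have h₂ := h.length_eq
    simp at h₁ h₂
    omega
  refine ⟨fun v => (l v).length, by simp [hl₀], fun v hv => ?_, fun v w h => ?_, fun v hv => ?_,
    fun v u w hu hw huw hnu hnw => ?_⟩
  · have := hl v
    rw [List.length_eq_zero_iff.1 hv] at this
    cases this
    rfl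
  · rcases hf v w h with h | h
    · left; simpa using h.length_eq
    · right; simpa using h.length_eq
  · cases hlv : l v with
    | nil => simp [hlv] at hv
    | cons u t =>
      refine ⟨u, ?_⟩
      exact hdown v u t (by rw [hlv])
  · have key : ∀ u, Y.graph.Adj v u → (l v).length = (l u).length + 1 →
        Y.PathEq (v :: l v) (v :: u :: l u) := by
      intro u hu hn
      rcases hf v u hu with h | h
      · have := h.length_eq
        simp at this
        omega
      · exact h
    obtain ⟨x, t, hs, h, -⟩ := exists_square_of_pathEq hflag huw
      ((key u hu hnu).symm.trans (key w hw hnw))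
    exact ⟨x, hs, (hdown u x t h).2⟩

omit hflag in
lemma graph_connected : Y.graph.Connected := by
  obtain ⟨p⟩ : Nonempty Y.Realization := inferInstance
  obtain ⟨v₀, -⟩ := exists_mem_openStar p
  refine { preconnected := fun u v => ?_, nonempty := ⟨v₀⟩ }
  exact graph_induction (P := fun v => Y.graph.Reachable u v) (.refl u)
    (fun v w h hv => hv.trans h.reachable) v

/-- The `1`-skeleton is bipartite and satisfies the quadrangle condition. -/
theorem dist_adj_and_quadrangle (p : V) :
    (∀ v w, Y.graph.Adj v w →
      Y.graph.dist p w = Y.graph.dist p v + 1 ∨ Y.graph.dist p v = Y.graph.dist p w + 1) ∧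
    ∀ v u w, Y.graph.Adj v u → Y.graph.Adj v w → u ≠ w →
      Y.graph.dist p v = Y.graph.dist p u + 1 → Y.graph.dist p v = Y.graph.dist p w + 1 →
        ∃ x, Y.IsSquare v u w x ∧ Y.graph.dist p u = Y.graph.dist p x + 1 := by
  obtain ⟨n, hn₀, hn₀', hadj, hdown, hquad⟩ := exists_height hflag p
  have hwalk : ∀ {u v : V} (W : Y.graph.Walk u v), n v ≤ n u + W.length := by
    intro u v W
    induction W with
    | nil => simp
    | cons h W ih =>
      rw [SimpleGraph.Walk.length_cons]
      rcases hadj _ _ h with h | h <;> omega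
  have hdist : ∀ k v, n v = k → ∃ W : Y.graph.Walk p v, W.length = k := by
    intro k
    induction k with
    | zero =>
      intro v hv
      obtain rfl := hn₀' v hv
      exact ⟨.nil, rfl⟩
    | succ k ih =>
      intro v hv
      obtain ⟨w, hw, hnw⟩ := hdown v (by omega)
      obtain ⟨W, hW⟩ := ih w (by omega)
      exact ⟨W.concat hw.symm, by simp [hW]⟩
  have hn : ∀ v, Y.graph.dist p v = n v := by
    intro v
    obtain ⟨W, hW⟩ := hdist _ v rfl
    obtain ⟨W', hW'⟩ := (graph_connected (Y := Y)).exists_walk_length_eq_dist p v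
    have h₁ := SimpleGraph.dist_le W
    have h₂ := hwalk W'
    omega
  simp only [hn]
  exact ⟨hadj, hquad⟩

end reducedPaths
end CubicalComplex

/-! ### Hyperplanes, gates and convexity of cubes. -/

namespace CubicalComplex

variable {V : Type*}

/-- A cubical complex with flag links, whose `1`-skeleton is connected and bipartite and satisfies
the quadrangle condition with respect to its squares. -/
structure HasQuadrangles (Y : CubicalComplex V) : Prop where
  flag : ∀ v, (Y.link v).IsFlag
  connected : Y.graph.Connected
  adj : ∀ p v w, Y.graph.Adj v w →
    Y.graph.dist p w = Y.graph.dist p v + 1 ∨ Y.graph.dist p v = Y.graph.dist p w + 1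
  quadrangle : ∀ p v u w, Y.graph.Adj v u → Y.graph.Adj v w → u ≠ w →
    Y.graph.dist p v = Y.graph.dist p u + 1 → Y.graph.dist p v = Y.graph.dist p w + 1 →
      ∃ x, Y.IsSquare v u w x ∧ Y.graph.dist p u = Y.graph.dist p x + 1

/-- The pairs `(a, b)` and `(x, y)`, which will be edges, are crossed by the same hyperplane, in
the same direction. -/
def IsParallelEdge (Y : CubicalComplex V) (a b x y : V) : Prop :=
  ∀ r, Y.graph.dist r a + Y.graph.dist r y = Y.graph.dist r b + Y.graph.dist r x

namespace HasQuadrangles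

variable {Y : CubicalComplex V} (hY : Y.HasQuadrangles)
include hY

local notation "d" => SimpleGraph.dist (graph Y)

lemma triangle (x y z : V) : d x z ≤ d x y + d y z := hY.connected.dist_triangle

omit hY in
lemma dist_comm (x y : V) : d x y = d y x := SimpleGraph.dist_comm

lemma lt_or_lt {v w : V} (h : Y.graph.Adj v w) (p : V) : d p v < d p w ∨ d p w < d p v := by
  rcases hY.adj p v w h with h | h <;> omega

lemma eq_add_one {v w : V} (h : Y.graph.Adj v w) {p : V} (hp : d p v < d p w) :
    d p w = d p v + 1 := by
  rcases hY.adj p v w h with h | h <;> omega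

lemma exists_adj_dist {x a : V} {k : ℕ} (h : d x a = k + 1) :
    ∃ z, Y.graph.Adj x z ∧ d z a = k := by
  obtain ⟨W, hW⟩ := hY.connected.exists_walk_length_eq_dist x a
  cases W with
  | nil => simp at h
  | cons hadj W =>
    rename_i z
    refine ⟨z, hadj, ?_⟩
    have h₁ := SimpleGraph.dist_le W
    have h₂ := hY.triangle x z a
    rw [SimpleGraph.dist_eq_one_iff_adj.2 hadj] at h₂
    simp at hW
    omega

/-- Opposite edges of a square are parallel. -/
lemma square_dist {v u w x : V} (h : Y.IsSquare v u w x) (p : V) :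
    d p u + d p w = d p v + d p x := by
  have key : ∀ {v u w x : V}, Y.IsSquare v u w x → d p v = d p u + 1 → d p v = d p w + 1 →
      d p u = d p x + 1 := by
    intro v u w x h h₁ h₂
    obtain ⟨y, hy, hd⟩ := hY.quadrangle p v u w h.adj₁ h.adj₂ h.ne₁ h₁ h₂
    rwa [h.unique hy]
  -- The only bad pattern has two opposite vertices both farther from `p` than the other two; `key`
  -- excludes it.
  rcases hY.adj p _ _ h.adj₁ with h₁ | h₁ <;> rcases hY.adj p _ _ h.adj₂ with h₂ | h₂ <;>
    rcases hY.adj p _ _ h.adj₃ with h₃ | h₃ <;> rcases hY.adj p _ _ h.adj₄ with h₄ | h₄ <;>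
    first
    | omega
    | (have := key h h₁ h₂; omega)
    | (have := key h.rotate h₁ h₃; omega)

/-- Edges that cross the same hyperplane are parallel. -/
lemma isParallelEdge_of_dist {a b x y : V} (hab : Y.graph.Adj a b) (hxy : Y.graph.Adj x y)
    (hx : d x a < d x b) (hy : d y b < d y a) : Y.IsParallelEdge a b x y := by
  induction hk : d x a generalizing x y with
  | zero =>
    have h₁ := hY.eq_add_one hab hx
    have h₂ := hY.eq_add_one hab.symm hy
    have h₃ := hY.triangle y x a
    rw [SimpleGraph.dist_eq_one_iff_adj.2 hxy.symm] at h₃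
    obtain rfl := hY.connected.dist_eq_zero_iff.1 hk
    obtain rfl := hY.connected.dist_eq_zero_iff.1 (show d y b = 0 by omega)
    intro r
    omega
  | succ k ih =>
    have h₁ := hY.eq_add_one hab hx
    have h₂ := hY.eq_add_one hab.symm hy
    have h₃ := hY.triangle y x a
    have h₄ := hY.triangle x y b
    rw [SimpleGraph.dist_eq_one_iff_adj.2 hxy.symm] at h₃
    rw [SimpleGraph.dist_eq_one_iff_adj.2 hxy] at h₄
    obtain ⟨z, hxz, hz⟩ := hY.exists_adj_dist hk
    have h₅ := hY.triangle x z b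
    have h₆ := hY.triangle z a b
    rw [SimpleGraph.dist_eq_one_iff_adj.2 hxz] at h₅
    rw [SimpleGraph.dist_eq_one_iff_adj.2 hab] at h₆
    have hyz : y ≠ z := by rintro rfl; omega
    -- The square pushes the edge `xy` to the parallel edge `zt`, one step nearer to `a`.
    obtain ⟨t, ht, htb⟩ := hY.quadrangle b x y z hxy hxz hyz
      (by rw [dist_comm b, dist_comm b]; omega) (by rw [dist_comm b, dist_comm b]; omega)
    rw [dist_comm b, dist_comm b] at htb
    have h₇ := hY.triangle y t a
    have h₈ := hY.triangle t b a
    rw [SimpleGraph.dist_eq_one_iff_adj.2 ht.adj₃] at h₇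
    rw [SimpleGraph.dist_eq_one_iff_adj.2 hab.symm] at h₈
    have := ih ht.adj₄ (by omega) (by omega) hz
    intro r
    have h₁ := this r
    have h₂ := hY.square_dist ht r
    omega

section chart

variable {n : ℕ} {e : (Fin n → Bool) → V} (he : IsCubeChart Y.cubes e)
include he

/-- Take `m` nearest to `p`. At `m` every flip increases the distance, and `square_dist` propagates
the sign in each direction over the cube. -/
lemma exists_gate_chart (p : V) : ∃ m : Fin n → Bool,
    ∀ b i, b i = m i → d p (e (flipAt b i)) = d p (e b) + 1 := by
  obtain ⟨m, hm⟩ := Finite.exists_min fun b => d p (e b)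
  suffices ∀ b, ∀ i, (b i = m i → d p (e (flipAt b i)) = d p (e b) + 1) ∧
      (b i ≠ m i → d p (e b) = d p (e (flipAt b i)) + 1) from ⟨m, fun b i => (this b i).1⟩
  refine flipAt_induction m (fun i => ⟨fun _ => ?_, fun h => absurd rfl h⟩) fun b j ih i => ?_
  · rcases hY.adj p _ _ (adj_flipAt he m i) with h | h
    · exact h
    · have := hm (flipAt m i)
      omega
  · by_cases hij : i = j
    · subst hij
      rw [flipAt_flipAt, flipAt_same]
      refine ⟨fun h => (ih i).2 ?_, fun h => (ih i).1 ?_⟩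
      · rw [← h]; simp
      · revert h; cases b i <;> cases m i <;> simp
    · rw [flipAt_of_ne _ hij]
      have := hY.square_dist (isSquare_flipAt he b (Ne.symm hij)) p
      refine ⟨fun h => ?_, fun h => ?_⟩
      · have := (ih i).1 h; omega
      · have := (ih i).2 h; omega

omit hY he in
lemma dist_flipAt_of_ne {p : V} {m : Fin n → Bool}
    (hm : ∀ b i, b i = m i → d p (e (flipAt b i)) = d p (e b) + 1) {b : Fin n → Bool} {i : Fin n}
    (h : b i ≠ m i) : d p (e b) = d p (e (flipAt b i)) + 1 := by
  have := hm (flipAt b i) i (by rw [flipAt_same]; revert h; cases b i <;> cases m i <;> simp)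
  rwa [flipAt_flipAt] at this

lemma dist_flipAt (μ b : Fin n → Bool) (i : Fin n) (h : b i = μ i) :
    d (e μ) (e (flipAt b i)) = d (e μ) (e b) + 1 := by
  obtain ⟨m, hm⟩ := hY.exists_gate_chart he (e μ)
  refine hm b i (h.trans ?_)
  by_contra hi
  have := dist_flipAt_of_ne hm hi
  simp at this

lemma dist_lt_flipAt_iff (μ b : Fin n → Bool) (i : Fin n) :
    d (e μ) (e b) < d (e μ) (e (flipAt b i)) ↔ b i = μ i := by
  constructor
  · intro h
    by_contra hi
    have := dist_flipAt_of_ne (hY.dist_flipAt he μ) hi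
    omega
  · intro h
    have := hY.dist_flipAt he μ b i h
    omega

lemma isParallelEdge_flipAt {b b' : Fin n → Bool} {i : Fin n} (h : b i = b' i) :
    Y.IsParallelEdge (e b) (e (flipAt b i)) (e b') (e (flipAt b' i)) := by
  intro r
  obtain ⟨m, hm⟩ := hY.exists_gate_chart he r
  by_cases hi : b i = m i
  · have h₁ := hm b i hi
    have h₂ := hm b' i (h ▸ hi)
    omega
  · have h₁ := dist_flipAt_of_ne hm hi
    have h₂ := dist_flipAt_of_ne hm (h ▸ hi)
    omega

end chart

/-- Cubes are gated. -/
lemma exists_gate {C : Set V} (hC : C ∈ Y.cubes) (p : V) :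
    ∃ m ∈ C, ∀ x ∈ C, d p x = d p m + d m x := by
  obtain ⟨n, e, he, rfl⟩ := Y.exists_chart C hC
  obtain ⟨m, hm⟩ := hY.exists_gate_chart he p
  refine ⟨e m, ⟨m, rfl⟩, ?_⟩
  rintro _ ⟨x, rfl⟩
  refine flipAt_induction (P := fun x => d p (e x) = d p (e m) + d (e m) (e x)) m (by simp)
    (fun b i ih => ?_) x
  by_cases hi : b i = m i
  · have h₁ := hm b i hi
    have h₂ := hY.dist_flipAt he m b i hi
    omega
  · have h₁ := dist_flipAt_of_ne hm hi
    have h₂ := dist_flipAt_of_ne (hY.dist_flipAt he m) hi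
    omega

/-- Cubes are convex. -/
lemma mem_of_dist_add {C : Set V} (hC : C ∈ Y.cubes) {x y z : V} (hx : x ∈ C) (hy : y ∈ C)
    (h : d x z + d z y = d x y) : z ∈ C := by
  obtain ⟨m, hm, hd⟩ := hY.exists_gate hC z
  have h₁ := hd x hx
  have h₂ := hd y hy
  have h₃ := hY.triangle x m y
  rw [dist_comm x z] at h
  rw [dist_comm x m] at h₃
  obtain rfl := hY.connected.dist_eq_zero_iff.1 (show d z m = 0 by omega)
  exact hm

lemma mem_of_adj_of_lt {C : Set V} (hC : C ∈ Y.cubes) {m s a : V} (hm : m ∈ C) (hs : s ∈ C)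
    (ha : Y.graph.Adj m a) (h : d s a < d s m) : a ∈ C := by
  refine hY.mem_of_dist_add hC hm hs ?_
  have := hY.eq_add_one ha.symm h
  rw [SimpleGraph.dist_eq_one_iff_adj.2 ha, dist_comm a, dist_comm m]
  omega

/-- Two hyperplanes that separate the same vertices of a cube cross in that cube, or coincide. -/
lemma isParallelEdge_or_exists {C : Set V} (hC : C ∈ Y.cubes) {a b a' b' u w : V}
    (hu : u ∈ C) (hw : w ∈ C) (hab : Y.graph.Adj a b) (hab' : Y.graph.Adj a' b')
    (hua : d u a < d u b) (hwb : d w b < d w a) (hua' : d u a' < d u b')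
    (hwb' : d w b' < d w a') :
    Y.IsParallelEdge a b a' b' ∨ ∃ x, d x a < d x b ∧ d x b' < d x a' := by
  obtain ⟨n, e, he, rfl⟩ := Y.exists_chart C hC
  obtain ⟨μ, rfl⟩ := hu
  obtain ⟨ν, rfl⟩ := hw
  -- A walk in the cube from `μ` to `ν` crosses the hyperplane, so inside the cube this hyperplane
  -- is given by one coordinate.
  have key : ∀ {a b}, Y.graph.Adj a b → d (e μ) a < d (e μ) b → d (e ν) b < d (e ν) a →
      ∃ β i, Y.IsParallelEdge a b (e β) (e (flipAt β i)) ∧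
        ∀ ξ, d (e ξ) a < d (e ξ) b ↔ β i = ξ i := by
    intro a b hab hμ hν
    obtain ⟨β, i, h₁, h₂⟩ : ∃ β i, d (e β) a < d (e β) b ∧
        d (e (flipAt β i)) b < d (e (flipAt β i)) a := by
      by_contra! hcon
      have := flipAt_induction (P := fun β => d (e β) a < d (e β) b) μ hμ
        (fun β i h => (hY.lt_or_lt hab _).resolve_right (hcon β i h).not_gt) ν
      omega
    have hpar := hY.isParallelEdge_of_dist hab (adj_flipAt he β i) h₁ h₂
    refine ⟨β, i, hpar, fun ξ => ?_⟩
    rw [← hY.dist_lt_flipAt_iff he]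
    have := hpar (e ξ)
    omega
  obtain ⟨β, i, hpar, hβ⟩ := key hab hua hwb
  obtain ⟨β', i', hpar', hβ'⟩ := key hab' hua' hwb'
  by_cases hi : i = i'
  · subst hi
    left
    have h := hY.isParallelEdge_flipAt he (((hβ μ).1 hua).trans ((hβ' μ).1 hua').symm)
    intro r
    have h₁ := hpar r
    have h₂ := hpar' r
    have h₃ := h r
    omega
  · right
    -- Coordinate `i` selects the side of `a` and coordinate `i'` the side of `b'`; the others are
    -- irrelevant.
    let ξ : Fin n → Bool := fun j => if j = i then β i else !(β' i')
    refine ⟨e ξ, (hβ ξ).2 (by simp [ξ]), (hY.lt_or_lt hab' _).resolve_left fun h => ?_⟩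
    have := (hβ' ξ).1 h
    simp [ξ, Ne.symm hi] at this

/-- Every edge of a cube has a parallel edge at every vertex of the cube. -/
lemma exists_isParallelEdge {C : Set V} (hC : C ∈ Y.cubes) {m g z : V} (hm : m ∈ C) (hg : g ∈ C)
    (hz : z ∈ C) (hgz : Y.graph.Adj g z) (h : d m z < d m g) :
    ∃ a ∈ C, Y.graph.Adj m a ∧ Y.IsParallelEdge m a z g := by
  obtain ⟨n, e, he, rfl⟩ := Y.exists_chart C hC
  obtain ⟨m, rfl⟩ := hm
  obtain ⟨g, rfl⟩ := hg
  obtain ⟨z, rfl⟩ := hz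
  obtain ⟨i, rfl⟩ := (adj_iff he).1 hgz.symm
  exact ⟨_, ⟨flipAt m i, rfl⟩, adj_flipAt he m i,
    hY.isParallelEdge_flipAt he ((hY.dist_lt_flipAt_iff he m z i).1 h).symm⟩

/-- A vertex of a cube `C` lies in the cube `D` if the edges of `C` that lead to it from a common
vertex do. -/
lemma mem_of_forall_adj {C D : Set V} (hC : C ∈ Y.cubes) (hD : D ∈ Y.cubes) {m w : V}
    (hmC : m ∈ C) (hmD : m ∈ D) (hw : w ∈ C)
    (h : ∀ a, Y.graph.Adj m a → d w a < d w m → a ∈ D) : w ∈ D := by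
  have hCD := Y.inter_mem C hC D hD ⟨m, hmC, hmD⟩
  obtain ⟨n, e, he, rfl⟩ := Y.exists_chart C hC
  obtain ⟨m, rfl⟩ := hmC
  obtain ⟨w, rfl⟩ := hw
  rw [← Set.image_preimage_eq_range_inter, he.image_mem_iff] at hCD
  obtain ⟨S, α, hS⟩ := hCD
  have hiff : ∀ b, e b ∈ D ↔ ∀ i ∈ S, b i = α i := fun b => Set.ext_iff.1 hS b
  rw [hiff] at hmD ⊢
  by_contra! hcon
  obtain ⟨i, hi, hwi⟩ := hcon
  -- Flipping the fixed coordinate `i` at `m` gives an edge towards `w` that leaves `D`.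
  have hmw : m i ≠ w i := by rw [hmD i hi]; exact hwi.symm
  have hlt := dist_flipAt_of_ne (hY.dist_flipAt he w) hmw
  have := (hiff _).1 (h (e (flipAt m i)) (adj_flipAt he m i) (by omega)) i hi
  rw [flipAt_same, ← hmD i hi] at this
  simp at this

/-! ### Common cubes and flagness of the thickening. -/

/-- Neighbours of `m` that are both closer to some vertex lie in a common cube with `m`. -/
lemma exists_cube_of_lt {m a b x : V} (ha : Y.graph.Adj m a) (hb : Y.graph.Adj m b)
    (hxa : d x a < d x m) (hxb : d x b < d x m) : ∃ C ∈ Y.cubes, m ∈ C ∧ a ∈ C ∧ b ∈ C := by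
  by_cases hab : a = b
  · subst hab
    exact ⟨_, ha.2, by simp⟩
  · obtain ⟨y, hs, -⟩ := hY.quadrangle x m a b ha hb hab (hY.eq_add_one ha.symm hxa)
      (hY.eq_add_one hb.symm hxb)
    obtain ⟨C, hC, h₁, h₂, h₃, -⟩ := hs.cube
    exact ⟨C, hC, h₁, h₂, h₃⟩

/-- The hyperplanes of `ma` and `mb` both separate `u` from `w`. They differ, since `m` lies between
them, so some vertex of `C` lies beyond both. -/
lemma exists_cube_of_separated {C : Set V} (hC : C ∈ Y.cubes) {m a b u w : V}
    (hu : u ∈ C) (hw : w ∈ C) (ha : Y.graph.Adj m a) (hb : Y.graph.Adj m b)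
    (hua : d u a < d u m) (hwa : d w m < d w a) (hub : d u m < d u b) (hwb : d w b < d w m) :
    ∃ C ∈ Y.cubes, m ∈ C ∧ a ∈ C ∧ b ∈ C := by
  rcases hY.isParallelEdge_or_exists hC hu hw ha.symm hb hua hwa hub hwb with h | ⟨x, h₁, h₂⟩
  · have := h m
    rw [SimpleGraph.dist_eq_one_iff_adj.2 ha, SimpleGraph.dist_self] at this
    omega
  · exact hY.exists_cube_of_lt ha hb h₁ h₂

/-- Finitely many cubes at `m` are faces of a common cube if their edges at `m` pairwise lie in
common cubes. -/
lemma exists_cube_of_pairwise (m : V) (S : Finset V) (hS : ∀ s ∈ S, ∃ C ∈ Y.cubes, m ∈ C ∧ s ∈ C)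
    (h : ∀ s ∈ S, ∀ t ∈ S, ∀ a b, Y.graph.Adj m a → Y.graph.Adj m b → d s a < d s m →
      d t b < d t m → ∃ C ∈ Y.cubes, m ∈ C ∧ a ∈ C ∧ b ∈ C) :
    ∃ E ∈ Y.cubes, m ∈ E ∧ ∀ s ∈ S, s ∈ E := by
  choose! C hC hmC hsC using hS
  have hfin : (⋃ s ∈ S, C s).Finite := S.finite_toSet.biUnion fun s hs => by
    obtain ⟨n, e, -, hr⟩ := Y.exists_chart _ (hC s hs)
    rw [← hr]
    exact Set.finite_range e
  have hN : {a | ∃ s ∈ S, Y.graph.Adj m a ∧ d s a < d s m}.Finite := hfin.subset fun a ha => by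
    obtain ⟨s, hs, hma, hlt⟩ := ha
    exact Set.mem_biUnion hs (hY.mem_of_adj_of_lt (hC s hs) (hmC s hs) (hsC s hs) hma hlt)
  obtain ⟨E, hE, hmE, hNE⟩ := exists_cube_of_isFlag (hY.flag m) hN.toFinset
    (fun a ha => by
      obtain ⟨s, hs, hma, hlt⟩ := hN.mem_toFinset.1 ha
      exact hma)
    (fun a ha b hb _ => by
      obtain ⟨s, hs, hma, hlt⟩ := hN.mem_toFinset.1 ha
      obtain ⟨t, ht, hmb, hlt'⟩ := hN.mem_toFinset.1 hb
      exact h s hs t ht a b hma hmb hlt hlt')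
  exact ⟨E, hE, hmE, fun s hs => hY.mem_of_forall_adj (hC s hs) hE (hmC s hs) hmE (hsC s hs)
    fun a ha hlt => hNE a (hN.mem_toFinset.2 ⟨s, hs, ha, hlt⟩)⟩

/-- Three vertices, any two of them in a common cube, lie in a common cube. -/
lemma exists_cube_of_triple {u v w : V} {A B C : Set V} (hA : A ∈ Y.cubes) (hB : B ∈ Y.cubes)
    (hC : C ∈ Y.cubes) (huA : u ∈ A) (hvA : v ∈ A) (huB : u ∈ B) (hwB : w ∈ B) (hvC : v ∈ C)
    (hwC : w ∈ C) : ∃ E ∈ Y.cubes, u ∈ E ∧ v ∈ E ∧ w ∈ E := by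
  classical
  -- The gate lies on geodesics from `u` to `v` and to `w`, hence in all three cubes by convexity.
  obtain ⟨m, hmC, hm⟩ := hY.exists_gate hC u
  have hmA := hY.mem_of_dist_add hA huA hvA (hm v hvC).symm
  have hmB := hY.mem_of_dist_add hB huB hwB (hm w hwC).symm
  have hpair : ∀ s ∈ ({u, v, w} : Finset V), ∀ t ∈ ({u, v, w} : Finset V),
      ∃ K ∈ Y.cubes, m ∈ K ∧ s ∈ K ∧ t ∈ K := by
    intro s hs t ht
    simp only [Finset.mem_insert, Finset.mem_singleton] at hs ht
    rcases hs with rfl | rfl | rfl <;> rcases ht with rfl | rfl | rfl <;>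
      first
      | exact ⟨A, hA, hmA, by assumption, by assumption⟩
      | exact ⟨B, hB, hmB, by assumption, by assumption⟩
      | exact ⟨C, hC, hmC, by assumption, by assumption⟩
  obtain ⟨E, hE, -, h⟩ := hY.exists_cube_of_pairwise m {u, v, w}
    (fun s hs => by
      obtain ⟨K, hK, h₁, h₂, -⟩ := hpair s hs s hs
      exact ⟨K, hK, h₁, h₂⟩)
    (fun s hs t ht a b ha hb hsa htb => by
      obtain ⟨K, hK, h₁, h₂, h₃⟩ := hpair s hs t ht
      exact ⟨K, hK, h₁, hY.mem_of_adj_of_lt hK h₁ h₂ ha hsa, hY.mem_of_adj_of_lt hK h₁ h₃ hb htb⟩)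
  exact ⟨E, hE, h u (by simp), h v (by simp), h w (by simp)⟩

theorem isFlag_thickening : Y.thickening.toPreAbstractSimplicialComplex.IsFlag := by
  intro S hne _ hS
  have hpair : ∀ v ∈ S, ∀ w ∈ S, ∃ C ∈ Y.cubes, v ∈ C ∧ w ∈ C := by
    intro v hv w hw
    by_cases hvw : v = w
    · subst hvw
      exact ⟨{v}, Y.vertex_mem v, rfl, rfl⟩
    · obtain ⟨-, t, ⟨-, C, hC, htC⟩, hvt, hwt⟩ := hS v hv w hw hvw
      exact ⟨C, hC, htC hvt, htC hwt⟩
  obtain ⟨v, hv⟩ := hne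
  obtain ⟨E, hE, -, h⟩ := hY.exists_cube_of_pairwise v S (fun s hs => hpair v hv s hs)
    (fun s hs t ht a b ha hb hsa htb => by
      obtain ⟨A, hA, h₁, h₂⟩ := hpair v hv s hs
      obtain ⟨B, hB, h₃, h₄⟩ := hpair v hv t ht
      obtain ⟨C, hC, h₅, h₆⟩ := hpair s hs t ht
      obtain ⟨K, hK, h₇, h₈, h₉⟩ := hY.exists_cube_of_triple hA hB hC h₁ h₂ h₃ h₄ h₅ h₆
      exact ⟨K, hK, h₇, hY.mem_of_adj_of_lt hK h₇ h₈ ha hsa, hY.mem_of_adj_of_lt hK h₇ h₉ hb htb⟩)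
  exact ⟨S, ⟨⟨v, hv⟩, E, hE, fun s hs => h s hs⟩, subset_rfl⟩

/-! ### Full 4-cycles. -/

/-- Vertices `s` and `t` that each lie in a common cube with `m`, but not in a common cube with each
other, are seen from `m` along two edges that do not lie in a common cube. -/
lemma exists_adj_of_not_cube {m s t : V} {A B : Set V} (hA : A ∈ Y.cubes) (hB : B ∈ Y.cubes)
    (hmA : m ∈ A) (hsA : s ∈ A) (hmB : m ∈ B) (htB : t ∈ B)
    (hst : ¬ ∃ C ∈ Y.cubes, s ∈ C ∧ t ∈ C) :
    ∃ a b, Y.graph.Adj m a ∧ Y.graph.Adj m b ∧ d s a < d s m ∧ d t b < d t m ∧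
      ¬ ∃ C ∈ Y.cubes, m ∈ C ∧ a ∈ C ∧ b ∈ C := by
  classical
  by_contra! hcon
  obtain ⟨E, hE, -, h⟩ := hY.exists_cube_of_pairwise m {s, t}
    (fun x hx => by
      simp only [Finset.mem_insert, Finset.mem_singleton] at hx
      rcases hx with rfl | rfl
      exacts [⟨A, hA, hmA, hsA⟩, ⟨B, hB, hmB, htB⟩])
    (fun x hx y hy a b ha hb hxa hyb => by
      simp only [Finset.mem_insert, Finset.mem_singleton] at hx hy
      rcases hx with rfl | rfl <;> rcases hy with rfl | rfl
      · exact hY.exists_cube_of_lt ha hb hxa hyb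
      · exact hcon a b ha hb hxa hyb
      · obtain ⟨C, hC, h₁, h₂, h₃⟩ := hcon b a hb ha hyb hxa
        exact ⟨C, hC, h₁, h₃, h₂⟩
      · exact hY.exists_cube_of_lt ha hb hxa hyb)
  exact hst ⟨E, hE, h s (by simp), h t (by simp)⟩

/-- If `r` were beyond the hyperplane of `mb`, then `s` or `r` would lie beyond both hyperplanes, or
each beyond exactly one; either way `a` and `b` would share a cube with `m`. -/
lemma lt_of_not_cube {m a b s r : V} {C : Set V} (hC : C ∈ Y.cubes) (hs : s ∈ C) (hr : r ∈ C)
    (ha : Y.graph.Adj m a) (hb : Y.graph.Adj m b) (hsa : d s a < d s m)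
    (hab : ¬ ∃ C ∈ Y.cubes, m ∈ C ∧ a ∈ C ∧ b ∈ C) : d r m < d r b := by
  refine (hY.lt_or_lt hb r).resolve_right fun hrb => hab ?_
  rcases hY.lt_or_lt ha r with hra | hra
  · rcases hY.lt_or_lt hb s with hsb | hsb
    · exact hY.exists_cube_of_separated hC hs hr ha hb hsa hra hsb hrb
    · exact hY.exists_cube_of_lt ha hb hsa hsb
  · exact hY.exists_cube_of_lt ha hb hra hrb

/-- If `m` is the vertex closest to `v₂` in the intersection of cubes that join `v₀` to `v₁` and to
`v₃`, and `v₂` lies in common cubes with `v₁` and `v₃`, then it does so with `m`. -/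
lemma exists_cube_of_gate {v₁ v₂ v₃ m : V} {C₀ C₁ C₂ C₃ : Set V}
    (h₀ : C₀ ∈ Y.cubes) (h₁ : C₁ ∈ Y.cubes) (h₂ : C₂ ∈ Y.cubes) (h₃ : C₃ ∈ Y.cubes)
    (hm₀ : m ∈ C₀) (hm₃ : m ∈ C₃) (h01 : v₁ ∈ C₀) (h11 : v₁ ∈ C₁) (h12 : v₂ ∈ C₁)
    (h22 : v₂ ∈ C₂) (h23 : v₃ ∈ C₂) (h33 : v₃ ∈ C₃)
    (hm : ∀ x ∈ C₀ ∩ C₃, d v₂ m ≤ d v₂ x) : ∃ C ∈ Y.cubes, m ∈ C ∧ v₂ ∈ C := by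
  classical
  -- Advance `g` along a geodesic from `m` to `v₂`, keeping `m` and `g` in a common cube.
  suffices ∀ k g, d g v₂ = k → d m g + d g v₂ = d m v₂ → (∃ E ∈ Y.cubes, m ∈ E ∧ g ∈ E) →
      ∃ C ∈ Y.cubes, m ∈ C ∧ v₂ ∈ C from
    this _ m rfl (by simp) ⟨{m}, Y.vertex_mem m, rfl, rfl⟩
  intro k
  induction k with
  | zero =>
    intro g hg _ hE
    obtain rfl := hY.connected.dist_eq_zero_iff.1 hg
    exact hE
  | succ k ih =>
    rintro g hg hmg ⟨E, hE, hmE, hgE⟩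
    obtain ⟨z, hgz, hz⟩ := hY.exists_adj_dist hg
    have hgz1 := SimpleGraph.dist_eq_one_iff_adj.2 hgz
    have key : ∀ e, Y.graph.Adj g e → d m e < d m g → ∃ C ∈ Y.cubes, g ∈ C ∧ e ∈ C ∧ z ∈ C := by
      intro e hge hme
      have heE := hY.mem_of_adj_of_lt hE hgE hmE hge hme
      obtain ⟨a, -, hma, hpar⟩ := hY.exists_isParallelEdge hE hmE hgE heE hge hme
      have hiff : ∀ r, d r a < d r m ↔ d r g < d r e := fun r => by
        have := hpar r
        omega
      have hv₂e : d v₂ g < d v₂ e := by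
        have := hY.triangle m e v₂
        rw [dist_comm e v₂] at this
        rw [dist_comm v₂ g]
        omega
      have hv₂z : d v₂ z < d v₂ g := by
        rw [dist_comm v₂, dist_comm v₂]
        omega
      have hfin : ∀ r C, C ∈ Y.cubes → r ∈ C → v₂ ∈ C → d r m < d r a →
          ∃ C ∈ Y.cubes, g ∈ C ∧ e ∈ C ∧ z ∈ C := by
        intro r C hC hr hv₂ hra
        have hre : d r e < d r g := (hY.lt_or_lt hge r).resolve_left fun h => by
          have := (hiff r).2 h
          omega
        rcases hY.lt_or_lt hgz r with hrz | hrz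
        · exact hY.exists_cube_of_separated hC hr hv₂ hge hgz hre hv₂e hrz hv₂z
        · exact hY.exists_cube_of_lt hge hgz hre hrz
      -- If `v₁` and `v₃` were both on the side of `a`, then `a` would lie in `C₀ ∩ C₃` and be
      -- nearer to `v₂` than `m`. So one of them is separated from `v₂` by the hyperplane of `ge`.
      rcases hY.lt_or_lt hma v₁ with h | hv₁
      · exact hfin v₁ C₁ h₁ h11 h12 h
      · rcases hY.lt_or_lt hma v₃ with h | hv₃
        · exact hfin v₃ C₂ h₂ h23 h22 h
        · have := hm a ⟨hY.mem_of_adj_of_lt h₀ hm₀ h01 hma hv₁,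
            hY.mem_of_adj_of_lt h₃ hm₃ h33 hma hv₃⟩
          have := (hiff v₂).2 hv₂e
          omega
    have hzz : ∀ b, d z b < d z g → b = z := by
      intro b hb
      rw [dist_comm z g, hgz1] at hb
      exact (hY.connected.dist_eq_zero_iff.1 (show d z b = 0 by omega)).symm
    obtain ⟨F, hF, -, h⟩ := hY.exists_cube_of_pairwise g {m, z}
      (fun x hx => by
        simp only [Finset.mem_insert, Finset.mem_singleton] at hx
        rcases hx with rfl | rfl
        exacts [⟨E, hE, hgE, hmE⟩, ⟨_, hgz.2, by simp⟩])
      (fun x hx y hy a b ha hb hxa hyb => by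
        simp only [Finset.mem_insert, Finset.mem_singleton] at hx hy
        rcases hx with rfl | rfl <;> rcases hy with rfl | rfl
        · exact hY.exists_cube_of_lt ha hb hxa hyb
        · obtain rfl := hzz b hyb
          exact key a ha hxa
        · obtain rfl := hzz a hxa
          obtain ⟨C, hC, h₁, h₂, h₃⟩ := key b hb hyb
          exact ⟨C, hC, h₁, h₃, h₂⟩
        · exact hY.exists_cube_of_lt ha hb hxa hyb)
    refine ih z hz ?_ ⟨F, hF, h m (by simp), h z (by simp)⟩
    have h₁ := hY.triangle m z v₂
    have h₂ := hY.triangle m g z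
    omega

/-- A full `4`-cycle in the thickening gives a full `4`-cycle in the link of some vertex. -/
theorem exists_link_cycle {v₀ v₁ v₂ v₃ : V}
    (h01 : ∃ C ∈ Y.cubes, v₀ ∈ C ∧ v₁ ∈ C) (h12 : ∃ C ∈ Y.cubes, v₁ ∈ C ∧ v₂ ∈ C)
    (h23 : ∃ C ∈ Y.cubes, v₂ ∈ C ∧ v₃ ∈ C) (h30 : ∃ C ∈ Y.cubes, v₃ ∈ C ∧ v₀ ∈ C)
    (h02 : ¬ ∃ C ∈ Y.cubes, v₀ ∈ C ∧ v₂ ∈ C) (h13 : ¬ ∃ C ∈ Y.cubes, v₁ ∈ C ∧ v₃ ∈ C) :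
    ∃ m a₀ a₁ a₂ a₃, (Y.graph.Adj m a₀ ∧ Y.graph.Adj m a₁ ∧ Y.graph.Adj m a₂ ∧
        Y.graph.Adj m a₃) ∧
      (∃ C ∈ Y.cubes, m ∈ C ∧ a₀ ∈ C ∧ a₁ ∈ C) ∧ (∃ C ∈ Y.cubes, m ∈ C ∧ a₁ ∈ C ∧ a₂ ∈ C) ∧
      (∃ C ∈ Y.cubes, m ∈ C ∧ a₂ ∈ C ∧ a₃ ∈ C) ∧ (∃ C ∈ Y.cubes, m ∈ C ∧ a₃ ∈ C ∧ a₀ ∈ C) ∧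
      (¬ ∃ C ∈ Y.cubes, m ∈ C ∧ a₀ ∈ C ∧ a₂ ∈ C) ∧ ¬ ∃ C ∈ Y.cubes, m ∈ C ∧ a₁ ∈ C ∧ a₃ ∈ C := by
  obtain ⟨C₀, hC₀, h00, h01⟩ := h01
  obtain ⟨C₁, hC₁, h11, h12⟩ := h12
  obtain ⟨C₂, hC₂, h22, h23⟩ := h23
  obtain ⟨C₃, hC₃, h33, h30⟩ := h30
  obtain ⟨m, ⟨hm₀, hm₃⟩, hm⟩ := hY.exists_gate (Y.inter_mem _ hC₀ _ hC₃ ⟨v₀, h00, h30⟩) v₂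
  obtain ⟨D, hD, hmD, h2D⟩ := hY.exists_cube_of_gate hC₀ hC₁ hC₂ hC₃ hm₀ hm₃ h01 h11 h12 h22 h23
    h33 fun x hx => by rw [hm x hx]; omega
  obtain ⟨a₀, a₂, ha₀, ha₂, h0a, h2a, hn02⟩ :=
    hY.exists_adj_of_not_cube hC₀ hD hm₀ h00 hmD h2D h02
  obtain ⟨a₁, a₃, ha₁, ha₃, h1a, h3a, hn13⟩ :=
    hY.exists_adj_of_not_cube hC₀ hC₃ hm₀ h01 hm₃ h33 h13
  have hn20 : ¬ ∃ C ∈ Y.cubes, m ∈ C ∧ a₂ ∈ C ∧ a₀ ∈ C := by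
    rintro ⟨C, hC, h₁, h₂, h₃⟩
    exact hn02 ⟨C, hC, h₁, h₃, h₂⟩
  have hn31 : ¬ ∃ C ∈ Y.cubes, m ∈ C ∧ a₃ ∈ C ∧ a₁ ∈ C := by
    rintro ⟨C, hC, h₁, h₂, h₃⟩
    exact hn13 ⟨C, hC, h₁, h₃, h₂⟩
  -- For consecutive indices, `lt_of_not_cube` shows that `vᵢ` is beyond the hyperplane of `aᵢ` but
  -- not that of `aᵢ₊₁`, and conversely for `vᵢ₊₁`; these two vertices share a cube.
  refine ⟨m, a₀, a₁, a₂, a₃, ⟨ha₀, ha₁, ha₂, ha₃⟩, ?_, ?_, ?_, ?_, hn02, hn13⟩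
  · exact hY.exists_cube_of_separated hC₀ h00 h01 ha₀ ha₁ h0a
      (hY.lt_of_not_cube hC₁ h12 h11 ha₂ ha₀ h2a hn20)
      (hY.lt_of_not_cube hC₃ h33 h30 ha₃ ha₁ h3a hn31) h1a
  · exact hY.exists_cube_of_separated hC₁ h11 h12 ha₁ ha₂ h1a
      (hY.lt_of_not_cube hC₂ h23 h22 ha₃ ha₁ h3a hn31)
      (hY.lt_of_not_cube hC₀ h00 h01 ha₀ ha₂ h0a hn02) h2a
  · exact hY.exists_cube_of_separated hC₂ h22 h23 ha₂ ha₃ h2a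
      (hY.lt_of_not_cube hC₃ h30 h33 ha₀ ha₂ h0a hn02)
      (hY.lt_of_not_cube hC₁ h11 h12 ha₁ ha₃ h1a hn13) h3a
  · exact hY.exists_cube_of_separated hC₃ h33 h30 ha₃ ha₀ h3a
      (hY.lt_of_not_cube hC₀ h01 h00 ha₁ ha₃ h1a hn13)
      (hY.lt_of_not_cube hC₂ h22 h23 ha₂ ha₀ h2a hn20) h0a

theorem isLarge_thickening (hloc : Y.IsLocallyLarge 5) :
    Y.thickening.toPreAbstractSimplicialComplex.IsLarge 5 := by
  refine ⟨hY.isFlag_thickening, fun j hj hj' c hc => ?_⟩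
  obtain rfl : j = 4 := by omega
  obtain ⟨hinj, hadj, hfull⟩ := hc
  have hedge : ∀ i, ∃ C ∈ Y.cubes, c i ∈ C ∧ c (i + 1) ∈ C := fun i => by
    obtain ⟨-, s, ⟨-, C, hC, hsC⟩, h₁, h₂⟩ := hadj i
    exact ⟨C, hC, hsC h₁, hsC h₂⟩
  -- A diagonal would be a simplex contained in no edge of the cycle.
  have hdiag : ∀ i, ¬ ∃ C ∈ Y.cubes, c i ∈ C ∧ c (i + 2) ∈ C := by
    classical
    rintro i ⟨C, hC, h₁, h₂⟩
    obtain ⟨k, hk⟩ := hfull {c i, c (i + 2)}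
      ⟨by simp, C, hC, by simp [Set.insert_subset_iff, h₁, h₂]⟩ (by simp)
    have hk₁ := hk (c i) (by simp)
    have hk₂ := hk (c (i + 2)) (by simp)
    rw [hinj.eq_iff, hinj.eq_iff] at hk₁ hk₂
    clear * - hk₁ hk₂
    revert i k
    decide
  obtain ⟨m, a₀, a₁, a₂, a₃, ⟨ha₀, ha₁, ha₂, ha₃⟩, q01, q12, q23, q30, n02, n13⟩ :=
    hY.exists_link_cycle (hedge 0) (hedge 1) (hedge 2) (hedge 3) (hdiag 0) (hdiag 1)
  have n20 : ¬ ∃ C ∈ Y.cubes, m ∈ C ∧ a₂ ∈ C ∧ a₀ ∈ C := by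
    rintro ⟨C, hC, h₁, h₂, h₃⟩
    exact n02 ⟨C, hC, h₁, h₃, h₂⟩
  have n31 : ¬ ∃ C ∈ Y.cubes, m ∈ C ∧ a₃ ∈ C ∧ a₁ ∈ C := by
    rintro ⟨C, hC, h₁, h₂, h₃⟩
    exact n13 ⟨C, hC, h₁, h₃, h₂⟩
  have e02 : a₀ ≠ a₂ := by rintro rfl; exact n02 ⟨_, ha₀.2, by simp⟩
  have e13 : a₁ ≠ a₃ := by rintro rfl; exact n13 ⟨_, ha₁.2, by simp⟩
  have e01 : a₀ ≠ a₁ := by rintro rfl; exact n02 q12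
  have e12 : a₁ ≠ a₂ := by rintro rfl; exact n13 q23
  have e23 : a₂ ≠ a₃ := by rintro rfl; exact n20 q30
  have e30 : a₃ ≠ a₀ := by rintro rfl; exact n31 q01
  have hlink : ∀ {a b}, Y.graph.Adj m a → Y.graph.Adj m b → a ≠ b →
      (∃ C ∈ Y.cubes, m ∈ C ∧ a ∈ C ∧ b ∈ C) → (Y.link m).oneSkeleton.Adj a b := by
    classical
    rintro a b ha hb hab ⟨C, hC, h₁, h₂, h₃⟩
    refine ⟨hab, {a, b}, ⟨by simp, ?_, C, hC, h₁, by simp [Set.insert_subset_iff, h₂, h₃]⟩,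
      by simp, by simp⟩
    simpa using ⟨⟨ha.1.symm, ha.2⟩, hb.1.symm, hb.2⟩
  let c' : ZMod 4 → V := (![a₀, a₁, a₂, a₃] : Fin 4 → V)
  have hc' : ∀ {P : ZMod 4 → Prop}, P 0 → P 1 → P 2 → P 3 → ∀ i, P i := by
    intro P p0 p1 p2 p3 i
    have : i = 0 ∨ i = 1 ∨ i = 2 ∨ i = 3 := by revert i; decide
    rcases this with rfl | rfl | rfl | rfl <;> assumption
  refine (hloc m).2 4 le_rfl (by norm_num) c' ⟨?_, ?_, ?_⟩
  · intro i j
    revert i j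
    refine hc' (hc' ?_ ?_ ?_ ?_) (hc' ?_ ?_ ?_ ?_) (hc' ?_ ?_ ?_ ?_) (hc' ?_ ?_ ?_ ?_) <;>
      intro h <;> first
        | rfl
        | exact absurd h e01 | exact absurd h e01.symm | exact absurd h e02
        | exact absurd h e02.symm | exact absurd h e30 | exact absurd h e30.symm
        | exact absurd h e12 | exact absurd h e12.symm | exact absurd h e13
        | exact absurd h e13.symm | exact absurd h e23 | exact absurd h e23.symm
  · exact hc' (hlink ha₀ ha₁ e01 q01) (hlink ha₁ ha₂ e12 q12) (hlink ha₂ ha₃ e23 q23)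
      (hlink ha₃ ha₀ e30 q30)
  · rintro s ⟨-, -, C, hC, hmC, hsC⟩ hs
    have hs' : ∀ v ∈ s, v = a₀ ∨ v = a₁ ∨ v = a₂ ∨ v = a₃ := by
      intro v hv
      obtain ⟨i, rfl⟩ := hs v hv
      revert i
      exact fun i _ => hc' (P := fun i => c' i = a₀ ∨ c' i = a₁ ∨ c' i = a₂ ∨ c' i = a₃)
        (.inl rfl) (.inr (.inl rfl)) (.inr (.inr (.inl rfl))) (.inr (.inr (.inr rfl))) i
    have h02 : ¬ (a₀ ∈ s ∧ a₂ ∈ s) := fun h => n02 ⟨C, hC, hmC, hsC h.1, hsC h.2⟩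
    have h13 : ¬ (a₁ ∈ s ∧ a₃ ∈ s) := fun h => n13 ⟨C, hC, hmC, hsC h.1, hsC h.2⟩
    by_cases h0 : a₀ ∈ s <;> by_cases h1 : a₁ ∈ s
    · refine ⟨0, fun v hv => show v = a₀ ∨ v = a₁ from ?_⟩
      rcases hs' v hv with rfl | rfl | rfl | rfl <;> tauto
    · refine ⟨3, fun v hv => show v = a₃ ∨ v = a₀ from ?_⟩
      rcases hs' v hv with rfl | rfl | rfl | rfl <;> tauto
    · refine ⟨1, fun v hv => show v = a₁ ∨ v = a₂ from ?_⟩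
      rcases hs' v hv with rfl | rfl | rfl | rfl <;> tauto
    · refine ⟨2, fun v hv => show v = a₂ ∨ v = a₃ from ?_⟩
      rcases hs' v hv with rfl | rfl | rfl | rfl <;> tauto

end HasQuadrangles

/-- A simply connected cubical complex with flag links satisfies the quadrangle condition. -/
theorem hasQuadrangles (Y : CubicalComplex V) [SimplyConnectedSpace Y.Realization]
    (hflag : ∀ v, (Y.link v).IsFlag) : Y.HasQuadrangles where
  flag := hflag
  connected := graph_connected
  adj p := (dist_adj_and_quadrangle hflag p).1
  quadrangle p := (dist_adj_and_quadrangle hflag p).2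

end CubicalComplex

theorem proposition3p4 {V : Type*} (Y : CubicalComplex V)
    (hY : SimplyConnectedSpace Y.Realization) (hloc : Y.IsLocallyLarge 5) :
    Y.thickening.toPreAbstractSimplicialComplex.IsLarge 5 :=
  (Y.hasQuadrangles fun v => (hloc v).1).isLarge_thickening hloc
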